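/- **Setting.** Let $k,p,q\in\mathbb N$, $\alpha\in(0,2)$, and let $|\cdot|$ be the Euclidean norm and $\|\cdot\|$ the operator norm. For each sample size $T$ we observe $(x_t,y_t)_{1\le t\le T}$, $x_t\in\mathbb R^p$, $y_t\in\mathbb R^q$ (a triangular array: the variables may depend on $T$), with $$y_t=x_t'\beta_j^0+u_t,\qquad T_{j-1}^0<t\le T_j^0,\quad j=1,\dots,k+1,$$ where $\beta_j^0\in\mathbb R^{p\times q}$, $T_0^0=0$, $T_{k+1}^0=T$. Fix $\varepsilon>0$. A partition $0=T_0<T_1<\dots<T_k<T_{k+1}=T$ is called admissible if $T_j-T_{j-1}\ge\varepsilon T$ for all $j$. Given an admissible partition, $\hat\beta=(\hat\beta_1,\dots,\hat\beta_{k+1})$ denotes a minimizer over $\beta=(\beta_1,\dots,\beta_{k+1})$ of $$\sum_{j=1}^{k+1}\sum_{t=T_{j-1}+1}^{T_j}\psi(x_t'\beta_j-y_t)+\gamma_T\,\varphi(\beta),$$ where $\psi$ is strictly convex, $\varphi$ is convex, both attain their global minimum at $0$, and $\gamma_T\ge0$. Let $\hat u_t=y_t-x_t'\hat\beta_j$ for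 $T_{j-1}<t\le T_j$, let $U_j=\{\hat u_t:T_{j-1}<t\le T_j\}$ and $n_j=T_j-T_{j-1}$. For samples $V=\{v_1,\dots,v_n\}$, $W=\{w_1,\dots,w_m\}$ in $\mathbb R^q$ put $$d_\alpha(V,W)=\frac{mn}{m+n}\Big(\frac{2}{mn}\sum_{i,j}|v_i-w_j|^\alpha-\tbinom n2^{-1}\sum_{i<l}|v_i-v_l|^\alpha-\tbinom m2^{-1}\sum_{j<l}|w_j-w_l|^\alpha\Big).$$ For all large $T$, the estimated change points $(\hat T_1,\dots,\hat T_k)$ minimize $$\sum_{1\le i<j\le k+1}\frac{n_i+n_j}{2T}\,d_\alpha(U_i,U_j)$$ over all admissible partitions. **Assumptions.** * (A1) $T_j^0=\lfloor T\lambda_j^0\rfloor$ with $0=\lambda_0^0<\lambda_1^0<\dots<\lambda_k^0<\lambda_{k+1}^0=1$; moreover $\varepsilon<\lambda_j^0-\lambda_{j-1}^0$ for all $j=1,\dots,k+1$. * (A2) For $T_{j-1}^0<t\le T_j^0$, $x_t$ has the law of a random vector $X_j$ (not depending on $t$ and $T$), and $\mathbb E|X_j|^{2\alpha}<\infty$.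 * (A3) The $u_t$ are i.i.d. with a law that does not depend on $T$, $u_t$ is independent of $x_s$ for all $t,s$, and $\mathbb E|u_t|^{2\alpha}<\infty$. * (A4) For all, possibly data-dependent, admissible partitions $(T_j)$ (one for each large $T$) such that each $T_j/T$ converges in probability to a constant, there are constant matrices $\beta_i^c$ with $\|\hat\beta_i-\beta_i^c\|\to0$ in probability for every $i$; moreover $\hat\beta_i$ is consistent for $\beta_i^0$ when its regime lies in the $i$-th true regime, that is, for every $\delta>0$, $\mathbb P\big(T_{i-1}^0\le T_{i-1},\ T_i\le T_i^0,\ \|\hat\beta_i-\beta_i^0\|\ge\delta\big)\to0$. * (A5) For all $c_1,c_2\in\mathbb R^{p\times q}$ and $Y_{i,j}=|u_i-u_j+x_i'c_1-x_j'c_2|^\alpha$, with all indices in the $l$-th true regime and uniformly in $T$: $\operatorname{Cov}(Y_{i_1,i_2},Y_{i_3,i_4})\to0$ as the minimal distance of the four indices tends to infinity, and $\mathbb E Y_{i_1,i_2}\to\mathbb E|U-\tilde U+X_l'c_1-\tilde X_l'c_2|^\alpha$ as $|i_1-i_2|\to\infty$, where $U,\tilde U,X_l,\tilde X_l$ are independent,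 $U,\tilde U$ distributed as $u_t$ and $X_l,\tilde X_l$ as in (A2). * (Genuine changes) For $l=1,\dots,k$ there is no matrix $b$ with both $X_l'b=X_l'\beta_l^0$ a.s. and $X_{l+1}'b=X_{l+1}'\beta_{l+1}^0$ a.s. (This holds if $\beta_l^0\ne\beta_{l+1}^0$ and $X_j'c=0$ a.s. only for $c=0$.) **Proposition 2.** Suppose that, for all $j=1,\dots,k$, $\hat T_j/T$ converges in probability, as $T\to\infty$, to a constant $\hat\lambda_j\in(0,1)$. Then $\hat\lambda_j=\lambda_j^0$ for all $j=1,\dots,k$. -/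

import Mathlib

open MeasureTheory ProbabilityTheory Filter Topology

noncomputable section

namespace EnergyCP

/-- `ℝⁿ` with the Euclidean norm. -/
abbrev Vec (n : ℕ) := EuclideanSpace ℝ (Fin n)

/-- A coefficient matrix `β ∈ ℝ^{p × q}`, identified with the linear map `x ↦ x'β` from `ℝᵖ` to
`ℝ^q`; its norm is the operator norm for the Euclidean norms. -/
abbrev Coef (p q : ℕ) := Vec p →L[ℝ] Vec q

/-- `(T_0, T_1, …, T_{k+1})` with `T_0 = 0` and `T_{k+1} = T`, every regime having length at least
`ε T`. -/
def IsAdmissible {k : ℕ} (ε : ℝ) (T : ℕ) (τ : Fin (k + 2) → ℕ) : Prop :=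
  τ 0 = 0 ∧ τ (Fin.last (k + 1)) = T ∧
    ∀ i : Fin (k + 1), ε * (T : ℝ) ≤ (τ i.succ : ℝ) - (τ i.castSucc : ℝ)

/-- The time points of the `i`-th regime of the partition `τ`. -/
def block {k : ℕ} (τ : Fin (k + 2) → ℕ) (i : Fin (k + 1)) : Finset ℕ :=
  Finset.Ioc (τ i.castSucc) (τ i.succ)

/-- The true change points `T_j⁰ = [T λ_j⁰]`. -/
def trueCP {k : ℕ} (lam0 : Fin (k + 2) → ℝ) (T : ℕ) : Fin (k + 2) → ℕ :=
  fun j => ⌊(T : ℝ) * lam0 j⌋₊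

/-- The penalized empirical risk of the coefficients `b = (b_1, …, b_{k+1})` for the partition `τ`
with loss `ψ`, penalty `φ` and penalty level `γ`. -/
def risk {k p q : ℕ} (ψ : Vec q → ℝ) (φ : (Fin (k + 1) → Coef p q) → ℝ) (γ : ℝ)
    (x : ℕ → Vec p) (y : ℕ → Vec q) (τ : Fin (k + 2) → ℕ) (b : Fin (k + 1) → Coef p q) : ℝ :=
  (∑ i, ∑ t ∈ block τ i, ψ (b i (x t) - y t)) + γ * φ b

/-- The average of `|v_i - w_j|^α` over `i ∈ A`, `j ∈ B`. -/
def meanBetween {q : ℕ} (α : ℝ) (A B : Finset ℕ) (v w : ℕ → Vec q) : ℝ :=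
  ((A.card : ℝ) * (B.card : ℝ))⁻¹ * ∑ i ∈ A, ∑ j ∈ B, ‖v i - w j‖ ^ α

/-- The average of `|v_i - v_j|^α` over the pairs `i < j` in `A`. -/
def meanWithin {q : ℕ} (α : ℝ) (A : Finset ℕ) (v : ℕ → Vec q) : ℝ :=
  ((A.card.choose 2 : ℕ) : ℝ)⁻¹ * ∑ i ∈ A, ∑ j ∈ A with i < j, ‖v i - v j‖ ^ α

/-- The empirical energy distance `d_α` of the samples `(v_i)_{i ∈ A}` and `(w_j)_{j ∈ B}`. -/
def energyDist {q : ℕ} (α : ℝ) (A B : Finset ℕ) (v w : ℕ → Vec q) : ℝ :=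
  ((A.card : ℝ) * (B.card : ℝ)) / ((A.card : ℝ) + (B.card : ℝ)) *
    (2 * meanBetween α A B v w - meanWithin α A v - meanWithin α B w)

/-- The goodness-of-fit statistic
`S_α = ∑_{i<j} (n_i + n_j) / (2T) * d_α(U_i, U_j)`, where the cluster `U_i` consists of the
residuals `y_t - x_t' b_i`, `t` in the `i`-th regime of `τ`. -/
def multiEnergy {k p q : ℕ} (α : ℝ) (T : ℕ) (x : ℕ → Vec p) (y : ℕ → Vec q)
    (τ : Fin (k + 2) → ℕ) (b : Fin (k + 1) → Coef p q) : ℝ :=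
  ∑ i : Fin (k + 1), ∑ j ∈ Finset.Ioi i,
    (((block τ i).card : ℝ) + ((block τ j).card : ℝ)) / (2 * (T : ℝ)) *
      energyDist α (block τ i) (block τ j)
        (fun t => y t - b i (x t)) (fun t => y t - b j (x t))

/-- For each `j = 1, …, k`, the fraction `T_j / T` converges in probability to `lam j`. -/
def FractionsTendsto {Ω : Type*} [MeasurableSpace Ω] (P : Measure Ω) {k : ℕ}
    (τ : ℕ → Ω → Fin (k + 2) → ℕ) (lam : Fin k → ℝ) : Prop :=
  ∀ j : Fin k, TendstoInMeasure P (fun T ω => (τ T ω j.succ.castSucc : ℝ) / (T : ℝ)) atTop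
    (fun _ => lam j)

/-- The regression model: `y_t = x_t' β_j⁰ + u_t` in the `j`-th true regime. -/
def Model {Ω : Type*} {k p q : ℕ} (lam0 : Fin (k + 2) → ℝ) (β0 : Fin (k + 1) → Coef p q)
    (x : ℕ → ℕ → Ω → Vec p) (y u : ℕ → ℕ → Ω → Vec q) : Prop :=
  ∀ T, ∀ j : Fin (k + 1), ∀ t ∈ block (trueCP lam0 T) j, ∀ ω,
    y T t ω = β0 j (x T t ω) + u T t ω

/-- The true change points are asymptotically distinct:
`0 = λ_0⁰ < λ_1⁰ < ⋯ < λ_k⁰ < λ_{k+1}⁰ = 1`. -/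
def A1 {k : ℕ} (lam0 : Fin (k + 2) → ℝ) : Prop :=
  StrictMono lam0 ∧ lam0 0 = 0 ∧ lam0 (Fin.last (k + 1)) = 1

/-- Within the `j`-th true regime every regressor has law `ν j`, with a finite moment of order
`2α`. -/
def A2 {Ω : Type*} [MeasurableSpace Ω] (P : Measure Ω) {k p : ℕ} (α : ℝ)
    (lam0 : Fin (k + 2) → ℝ) (x : ℕ → ℕ → Ω → Vec p) (ν : Fin (k + 1) → Measure (Vec p)) : Prop :=
  (∀ T, ∀ j : Fin (k + 1), ∀ t ∈ block (trueCP lam0 T) j, HasLaw (x T t) (ν j) P) ∧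
    ∀ j, Integrable (fun z => ‖z‖ ^ (2 * α)) (ν j)

/-- The disturbances are i.i.d. with law `μ`, which has a finite moment of order `2α`, and each
`u_t` is independent of each `x_s`. -/
def A3 {Ω : Type*} [MeasurableSpace Ω] (P : Measure Ω) {p q : ℕ} (α : ℝ)
    (x : ℕ → ℕ → Ω → Vec p) (u : ℕ → ℕ → Ω → Vec q) (μ : Measure (Vec q)) : Prop :=
  (∀ T, ∀ t ∈ Finset.Icc 1 T, HasLaw (u T t) μ P) ∧
  (∀ T, iIndepFun (fun t : Finset.Icc 1 T => u T t) P) ∧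
  (∀ T, ∀ t ∈ Finset.Icc 1 T, ∀ s ∈ Finset.Icc 1 T, IndepFun (u T t) (x T s) P) ∧
  Integrable (fun z => ‖z‖ ^ (2 * α)) μ

/-- For any (possibly data-dependent) admissible change points `τ` whose fractions converge, the
regularized estimators converge in probability to constants; and the estimator of a regime is
consistent when that regime of `τ` lies in the corresponding true regime: the probability that it
does so while the estimator is off by `δ` or more tends to `0`. -/
def A4 {Ω : Type*} [MeasurableSpace Ω] (P : Measure Ω) {k p q : ℕ} (ε : ℝ)
    (lam0 : Fin (k + 2) → ℝ) (β0 : Fin (k + 1) → Coef p q)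
    (βhat : ℕ → (Fin (k + 2) → ℕ) → Ω → Fin (k + 1) → Coef p q) : Prop :=
  ∀ τ : ℕ → Ω → Fin (k + 2) → ℕ, (∀ T, Measurable (τ T)) →
    (∀ᶠ T in atTop, ∀ ω, IsAdmissible ε T (τ T ω)) →
    ∀ lam : Fin k → ℝ, FractionsTendsto P τ lam →
      (∃ βc : Fin (k + 1) → Coef p q, ∀ i,
        TendstoInMeasure P (fun T ω => βhat T (τ T ω) ω i) atTop (fun _ => βc i)) ∧
      ∀ i : Fin (k + 1), ∀ δ : ℝ, 0 < δ →
        Tendsto (fun T => P {ω | trueCP lam0 T i.castSucc ≤ τ T ω i.castSucc ∧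
            τ T ω i.succ ≤ trueCP lam0 T i.succ ∧
            δ ≤ ‖βhat T (τ T ω) ω i - β0 i‖}) atTop (𝓝 0)

/-- `Y_{i,j} = |u_i - u_j + x_i' c₁ - x_j' c₂|^α`. -/
def pairDist {Ω : Type*} {p q : ℕ} (α : ℝ) (c₁ c₂ : Coef p q) (x : ℕ → Ω → Vec p)
    (u : ℕ → Ω → Vec q) (i j : ℕ) (ω : Ω) : ℝ :=
  ‖u i ω - u j ω + c₁ (x i ω) - c₂ (x j ω)‖ ^ α

/-- Asymptotic independence of the regressors within each true regime: uniformly in `T`,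
covariances of `Y_{i₁,i₂}` and `Y_{i₃,i₄}` vanish and the mean of `Y_{i₁,i₂}` tends to its value
for independent copies, as the time points move apart. -/
def A5 {Ω : Type*} [MeasurableSpace Ω] (P : Measure Ω) {k p q : ℕ} (α : ℝ)
    (lam0 : Fin (k + 2) → ℝ) (x : ℕ → ℕ → Ω → Vec p) (u : ℕ → ℕ → Ω → Vec q)
    (ν : Fin (k + 1) → Measure (Vec p)) (μ : Measure (Vec q)) : Prop :=
  ∀ c₁ c₂ : Coef p q, ∀ j : Fin (k + 1), ∀ δ : ℝ, 0 < δ → ∃ N : ℕ, ∀ T : ℕ,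
    (∀ s : Fin 4 → ℕ, (∀ l, s l ∈ block (trueCP lam0 T) j) →
      (∀ l m, l ≠ m → (N : ℤ) ≤ |(s l : ℤ) - (s m : ℤ)|) →
      |covariance (pairDist α c₁ c₂ (x T) (u T) (s 0) (s 1))
        (pairDist α c₁ c₂ (x T) (u T) (s 2) (s 3)) P| < δ) ∧
    (∀ s₁ ∈ block (trueCP lam0 T) j, ∀ s₂ ∈ block (trueCP lam0 T) j,
      (N : ℤ) ≤ |(s₁ : ℤ) - (s₂ : ℤ)| →
      |(∫ ω, pairDist α c₁ c₂ (x T) (u T) s₁ s₂ ω ∂P) -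
        ∫ z, ‖z.1.1 - z.1.2 + c₁ z.2.1 - c₂ z.2.2‖ ^ α
          ∂((μ.prod μ).prod ((ν j).prod (ν j)))| < δ)

/-- Genuine structural changes: no single coefficient matrix `b` reproduces the regression
function of two neighbouring true regimes almost surely. This follows from `β_l⁰ ≠ β_{l+1}⁰` if
no nonzero `c` has `X_j' c = 0` almost surely. -/
def GenuineChanges {k p q : ℕ} (β0 : Fin (k + 1) → Coef p q)
    (ν : Fin (k + 1) → Measure (Vec p)) : Prop :=
  ∀ l : Fin k, ¬ ∃ b : Coef p q,
    (∀ᵐ z ∂(ν l.castSucc), b z = β0 l.castSucc z) ∧ (∀ᵐ z ∂(ν l.succ), b z = β0 l.succ z)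

end EnergyCP

end

/-! For `0 < α < 2` the quantity `|v - w|^α` is a squared Hilbert space distance. With `d` the
dimension, the functions `s ↦ |s|^{-(d+α)/2} (exp(i⟨v,s⟩) - 1)`, suitably normalized, embed the
residual space into `L²` by a map `Φ`, and the mean of `Φ` under a probability law determines that
law (`exists_hilbert_embedding`). Up to a vanishing diagonal correction, the energy distance of two
samples is therefore `2mn/(m+n)` times the squared distance of their averaged embeddings. The
weights `(n_i + n_j)/(2T)` cancel the denominators, and the statistic divided by `T` tends to
`∑_{i<j} w_i w_j ‖m_i - m_j‖²`, where `w_i` is the limiting length of regime `i` and `m_i` is the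
mean embedding of a mixture, over the true regimes `l` met by regime `i`, of the laws of `U +
X_l'(β_l⁰ - β_i^c)` (`IsPowerEmbedding.tendsto_multiEnergy_of_fractions`).

For the true partition consistency makes every `m_i` equal to `E Φ(U)`, so the limit is `0`.
Minimality then forces all `m_i` of the estimated partition to coincide. Two partitions with equally
many regimes always have an index `i` for which the `i`-th regime of one lies in the `i`-th regime
of the other (`exists_regime_le`). Some such `i` recurs for infinitely many `T`, and (A4) then gives
`β_i^c = β_i⁰`. Hence the common value of the `m_j` is `E Φ(U)`.

By injectivity of the mean embedding each mixture equals the law `μ` of `U`. It also has the form `μ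
∗ G`, with `G` the mixture of the laws of `X_l'(β_l⁰ - β_j^c)`, and `μ ∗ G = μ` forces `G` to be
concentrated at `0` (`ae_eq_zero_of_conv_eq_self`). If the limiting fractions were wrong, some true
`λ_l⁰` would lie strictly inside a limiting regime `j`, and the single matrix `β_j^c` would
reproduce the regression functions on both sides of `λ_l⁰`, contradicting genuine change.

Probability enters only through finitely many sequences that tend to `0` in probability and a bound
on average moments. `exists_selection` picks one outcome for each `T` along which all of these
converge, and the rest (`IsPowerEmbedding.fractions_eq`) is deterministic. -/

noncomputable section

namespace EnergyCP

/-! ### The embedding into `L²`. -/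

section Embedding

variable {E : Type*} [NormedAddCommGroup E] [InnerProductSpace ℝ E] [FiniteDimensional ℝ E]
  [MeasurableSpace E] [BorelSpace E]

/-- The function `s ↦ |s|^{-(d+α)/2} (exp(i⟨v,s⟩) - 1)`, whose `L²` distance for `v` and `w` is
proportional to `|v - w|^{α/2}`. -/
def kernelFun (α : ℝ) (v s : E) : ℂ :=
  (‖s‖ ^ (-((Module.finrank ℝ E : ℝ) + α) / 2)) • (Complex.exp (inner ℝ v s * Complex.I) - 1)

/-- The constant bound serves for large frequencies, the quadratic one near the origin. -/
lemma norm_exp_mul_I_sub_one_sq_le (θ : ℝ) :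
    ‖Complex.exp (θ * Complex.I) - 1‖ ^ 2 ≤ min 4 (θ ^ 2) := by
  refine le_min ?_ ?_
  · have h : ‖Complex.exp (θ * Complex.I) - 1‖ ≤ 2 := by
      refine (norm_sub_le _ _).trans ?_
      rw [Complex.norm_exp_ofReal_mul_I, norm_one]; norm_num
    nlinarith [norm_nonneg (Complex.exp (θ * Complex.I) - 1)]
  · have h := Real.norm_exp_I_mul_ofReal_sub_one_le (x := θ)
    rw [mul_comm] at h
    rw [← sq_abs θ]
    exact pow_le_pow_left₀ (norm_nonneg _) h 2

lemma measurable_kernelFun (α : ℝ) (v : E) : Measurable (kernelFun α v) := by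
  unfold kernelFun
  have h : Continuous fun s : E => Complex.exp (inner ℝ v s * Complex.I) - 1 := by fun_prop
  exact (measurable_norm.pow_const _).smul h.measurable

lemma norm_sq_smul_rpow {V : Type*} [NormedAddCommGroup V] (d : ℝ) {s : V} (z : ℂ) :
    ‖(‖s‖ ^ (-d / 2)) • z‖ ^ 2 = ‖s‖ ^ (-d) * ‖z‖ ^ 2 := by
  rw [norm_smul, mul_pow, Real.norm_of_nonneg (by positivity), ← Real.rpow_natCast,
    ← Real.rpow_mul (norm_nonneg _)]
  congr 2
  push_cast; ring

/-- In polar coordinates the integrand becomes `r^(-1-α) min(4, b r²)`. It is of order `r^(1-α)` at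
the origin, integrable because `α < 2`, and of order `r^(-1-α)` at infinity, integrable because `α >
0`. -/
lemma integrable_norm_rpow_mul_min [Nontrivial E] {α : ℝ} (hα : α ∈ Set.Ioo (0 : ℝ) 2) {b : ℝ}
    (hb : 0 ≤ b) :
    Integrable fun s : E => ‖s‖ ^ (-((Module.finrank ℝ E : ℝ) + α)) * min 4 (b * ‖s‖ ^ 2) := by
  have key := integrable_fun_norm_addHaar (E := E) volume
    (f := fun r : ℝ => r ^ (-((Module.finrank ℝ E : ℝ) + α)) * min 4 (b * r ^ 2))
  rw [key]
  have hd : 1 ≤ Module.finrank ℝ E := Module.finrank_pos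
  have hrw : ∀ r : ℝ, 0 < r → r ^ (Module.finrank ℝ E - 1) •
      (r ^ (-((Module.finrank ℝ E : ℝ) + α)) * min 4 (b * r ^ 2))
      = r ^ (-1 - α) * min 4 (b * r ^ 2) := by
    intro r hr
    rw [smul_eq_mul, ← mul_assoc, ← Real.rpow_natCast, ← Real.rpow_add hr, Nat.cast_sub hd]
    congr 2; push_cast; ring
  have hmeas : Measurable fun r : ℝ => r ^ (-1 - α) * min 4 (b * r ^ 2) := by
    fun_prop
  rw [integrableOn_congr_fun (s := Set.Ioi (0 : ℝ)) (fun r hr => hrw r hr) measurableSet_Ioi,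
    ← Set.Ioc_union_Ioi_eq_Ioi (zero_le_one' ℝ)]
  refine IntegrableOn.union ?_ ?_
  · have h1 : IntegrableOn (fun r : ℝ => b * r ^ (1 - α)) (Set.Ioc 0 1) := by
      refine Integrable.const_mul ?_ _
      have := intervalIntegral.intervalIntegrable_rpow' (a := 0) (b := 1) (r := 1 - α)
        (by linarith [hα.2])
      rwa [intervalIntegrable_iff_integrableOn_Ioc_of_le zero_le_one] at this
    refine Integrable.mono' h1 hmeas.aestronglyMeasurable ?_
    refine (ae_restrict_iff' measurableSet_Ioc).2 (Eventually.of_forall fun r hr => ?_)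
    have hr0 : 0 < r := hr.1
    have h2 : r ^ (1 - α) = r ^ (-1 - α) * r ^ 2 := by
      rw [← Real.rpow_natCast, ← Real.rpow_add hr0]; congr 1; push_cast; ring
    rw [Real.norm_of_nonneg (by positivity), h2]
    calc _ ≤ r ^ (-1 - α) * (b * r ^ 2) := by gcongr; exact min_le_right _ _
      _ = _ := by ring
  · have h1 : IntegrableOn (fun r : ℝ => 4 * r ^ (-1 - α)) (Set.Ioi 1) :=
      Integrable.const_mul ((integrableOn_Ioi_rpow_iff zero_lt_one).2 (by linarith [hα.1])) _
    refine Integrable.mono' h1 hmeas.aestronglyMeasurable ?_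
    refine (ae_restrict_iff' measurableSet_Ioi).2 (Eventually.of_forall fun r hr => ?_)
    have hr0 : 0 < r := zero_lt_one.trans hr
    rw [Real.norm_of_nonneg (by positivity), mul_comm 4]
    gcongr
    exact min_le_left _ _

lemma integrable_norm_kernelFun_sq [Nontrivial E] {α : ℝ} (hα : α ∈ Set.Ioo (0 : ℝ) 2) (v : E) :
    Integrable fun s => ‖kernelFun α v s‖ ^ 2 := by
  refine Integrable.mono' (integrable_norm_rpow_mul_min hα (sq_nonneg ‖v‖))
    ((measurable_kernelFun α v).norm.pow_const 2).aestronglyMeasurable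
    (Eventually.of_forall fun s => ?_)
  rw [Real.norm_of_nonneg (by positivity), kernelFun, norm_sq_smul_rpow]
  gcongr
  refine (norm_exp_mul_I_sub_one_sq_le _).trans (min_le_min_left _ ?_)
  rw [← mul_pow, ← sq_abs]
  exact pow_le_pow_left₀ (abs_nonneg _) (abs_real_inner_le_norm v s) 2

lemma memLp_kernelFun [Nontrivial E] {α : ℝ} (hα : α ∈ Set.Ioo (0 : ℝ) 2) (v : E) :
    MemLp (kernelFun α v) 2 :=
  (memLp_two_iff_integrable_sq_norm (measurable_kernelFun α v).aestronglyMeasurable).2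
    (integrable_norm_kernelFun_sq hα v)

/-- The squared `L²` norm of `kernelFun α v`. -/
def kernelNormSq (α : ℝ) (v : E) : ℝ := ∫ s, ‖kernelFun α v s‖ ^ 2

lemma kernelNormSq_isometry (α : ℝ) (L : E ≃ₗᵢ[ℝ] E) (v : E) :
    kernelNormSq α (L v) = kernelNormSq α v := by
  unfold kernelNormSq
  rw [← L.measurePreserving.integral_comp' (f := L.toMeasurableEquiv)]
  congr 1; ext s
  simp [kernelFun]

/-- Substituting `r s` for `s` brings out `r^(d+α)` from the weight and `r^(-d)` from the Jacobian.
-/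
lemma kernelNormSq_smul {α r : ℝ} (hr : 0 < r) (v : E) :
    kernelNormSq α (r • v) = r ^ α * kernelNormSq α v := by
  unfold kernelNormSq
  have h : ∀ s : E, ‖kernelFun α (r • v) s‖ ^ 2 =
      r ^ ((Module.finrank ℝ E : ℝ) + α) * ‖kernelFun α v (r • s)‖ ^ 2 := by
    intro s
    rw [kernelFun, kernelFun, norm_sq_smul_rpow, norm_sq_smul_rpow, real_inner_smul_left,
      real_inner_smul_right, norm_smul, Real.mul_rpow (norm_nonneg _) (norm_nonneg _),
      Real.norm_of_nonneg hr.le, ← mul_assoc, ← mul_assoc, ← Real.rpow_add hr]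
    simp
  simp_rw [h]
  rw [integral_const_mul, Measure.integral_comp_smul volume (fun s => ‖kernelFun α v s‖ ^ 2) r,
    smul_eq_mul, ← mul_assoc, abs_of_pos (by positivity), Real.rpow_add hr, Real.rpow_natCast]
  have : r ^ Module.finrank ℝ E ≠ 0 := by positivity
  field_simp

lemma kernelNormSq_zero (α : ℝ) : kernelNormSq α (0 : E) = 0 := by
  simp [kernelNormSq, kernelFun]

/-- Rotation invariance and homogeneity leave only a constant free: the reflection in the hyperplane
orthogonal to `v - ‖v‖ e` carries `v` to `‖v‖ e`. -/
lemma kernelNormSq_eq {α : ℝ} (hα : 0 < α) {e : E} (he : ‖e‖ = 1) (v : E) :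
    kernelNormSq α v = ‖v‖ ^ α * kernelNormSq α e := by
  rcases eq_or_ne v 0 with rfl | hv
  · rw [kernelNormSq_zero, norm_zero, Real.zero_rpow hα.ne', zero_mul]
  have hv' : 0 < ‖v‖ := norm_pos_iff.2 hv
  rw [← kernelNormSq_smul hv',
    ← kernelNormSq_isometry α (Submodule.reflection (Submodule.span ℝ {v - ‖v‖ • e})ᗮ) v,
    Submodule.reflection_sub]
  rw [norm_smul, he, norm_norm, mul_one]

/-- If the integral vanished, `exp(i⟨e,s⟩)` would be `1` for every `s` by continuity, but at `s = π
e` it is `-1`. -/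
lemma kernelNormSq_pos [Nontrivial E] {α : ℝ} (hα : α ∈ Set.Ioo (0 : ℝ) 2) {e : E}
    (he : ‖e‖ = 1) : 0 < kernelNormSq α e := by
  refine lt_of_le_of_ne (integral_nonneg fun _ => by positivity) fun h => ?_
  have h0 := (integral_eq_zero_iff_of_nonneg (fun _ => by positivity)
    (integrable_norm_kernelFun_sq hα e)).1 h.symm
  have hne : ∀ᵐ s : E, s ≠ 0 := by simp [ae_iff, measure_singleton]
  have h1 : (fun s : E => Complex.exp (inner ℝ e s * Complex.I)) =ᵐ[volume] fun _ => 1 := by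
    filter_upwards [h0, hne] with s hs hs0
    have hs' : 0 < ‖s‖ := norm_pos_iff.2 hs0
    simp only [kernelFun, Pi.zero_apply, norm_sq_smul_rpow] at hs
    have := (mul_eq_zero.1 hs).resolve_left (by positivity)
    exact sub_eq_zero.1 (norm_eq_zero.1 (pow_eq_zero_iff two_ne_zero |>.1 this))
  have h2 := (Continuous.ae_eq_iff_eq volume (by fun_prop) (by fun_prop)).1 h1
  have h3 := congrFun h2 (Real.pi • e)
  rw [real_inner_smul_right, real_inner_self_eq_norm_sq, he, one_pow, mul_one,
    Complex.exp_pi_mul_I] at h3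
  norm_num at h3

/-- The unnormalized embedding of `E` into `L²`. -/
def kernelLp [Nontrivial E] {α : ℝ} (hα : α ∈ Set.Ioo (0 : ℝ) 2) (v : E) :
    Lp ℂ 2 (volume : Measure E) := (memLp_kernelFun hα v).toLp

lemma norm_sq_eq_integral_norm_sq {X : Type*} [MeasurableSpace X] {m : Measure X}
    (f : Lp ℂ 2 m) : ‖f‖ ^ 2 = ∫ s, ‖f s‖ ^ 2 ∂m := by
  rw [← real_inner_self_eq_norm_sq, L2.inner_def]
  simp

/-- Translation invariance: the factor `exp(i⟨w,s⟩)` has modulus one and can be taken out of the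
difference. -/
lemma norm_kernelLp_sub_sq [Nontrivial E] {α : ℝ} (hα : α ∈ Set.Ioo (0 : ℝ) 2) (v w : E) :
    ‖kernelLp hα v - kernelLp hα w‖ ^ 2 = kernelNormSq α (v - w) := by
  rw [kernelLp, kernelLp, ← MemLp.toLp_sub, norm_sq_eq_integral_norm_sq, kernelNormSq]
  refine integral_congr_ae ?_
  filter_upwards [((memLp_kernelFun hα v).sub (memLp_kernelFun hα w)).coeFn_toLp] with s hs
  rw [hs, Pi.sub_apply, kernelFun, kernelFun, kernelFun, ← smul_sub, norm_sq_smul_rpow,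
    norm_sq_smul_rpow]
  congr 2
  have h : Complex.exp (inner ℝ v s * Complex.I) - 1 - (Complex.exp (inner ℝ w s * Complex.I) - 1)
      = Complex.exp (inner ℝ w s * Complex.I) *
        (Complex.exp (inner ℝ (v - w) s * Complex.I) - 1) := by
    rw [mul_sub, ← Complex.exp_add, inner_sub_left]; push_cast; ring_nf
  rw [h, norm_mul, Complex.norm_exp_ofReal_mul_I, one_mul]

lemma kernelLp_zero [Nontrivial E] {α : ℝ} (hα : α ∈ Set.Ioo (0 : ℝ) 2) :
    kernelLp hα (0 : E) = 0 := by
  have h : kernelFun α (0 : E) = 0 := by ext s; simp [kernelFun]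
  rw [kernelLp, Lp.eq_zero_iff_ae_eq_zero]
  filter_upwards [(memLp_kernelFun hα (0 : E)).coeFn_toLp] with s hs
  rw [hs, h]

end Embedding

/-! ### Injectivity of the mean embedding, and cancellation in convolutions. -/

section Embedding

variable {E : Type*} [NormedAddCommGroup E] [InnerProductSpace ℝ E] [FiniteDimensional ℝ E]
  [MeasurableSpace E] [BorelSpace E]

/-- These are the test functions for mean embeddings. With `a = (d+α)/2` the weight cancels the
singular one in `kernelFun`, and the cut-off to a ball makes the product square integrable. -/
lemma memLp_indicator_ball_rpow_smul {D : E → ℂ} (hD : Continuous D) {C : ℝ}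
    (hC : ∀ s, ‖D s‖ ≤ C) {a : ℝ} (ha : 0 ≤ a) (R : ℝ) :
    MemLp ((Metric.ball (0 : E) R).indicator fun s => (‖s‖ ^ a) • D s) 2 := by
  rw [memLp_indicator_iff_restrict measurableSet_ball]
  have : IsFiniteMeasure (volume.restrict (Metric.ball (0 : E) R)) :=
    ⟨by rw [Measure.restrict_apply_univ]; exact measure_ball_lt_top⟩
  refine MemLp.of_bound ((measurable_norm.pow_const a).smul hD.measurable).aestronglyMeasurable
    (R ^ a * C) ?_
  refine (ae_restrict_iff' measurableSet_ball).2 (Eventually.of_forall fun s hs => ?_)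
  rw [norm_smul, Real.norm_of_nonneg (by positivity)]
  have := (mem_ball_zero_iff.1 hs).le
  exact mul_le_mul (Real.rpow_le_rpow (norm_nonneg _) this ha) (hC s) (norm_nonneg _)
    (Real.rpow_nonneg ((norm_nonneg _).trans this) _)

lemma inner_toLp_kernelLp [Nontrivial E] {α : ℝ} (hα : α ∈ Set.Ioo (0 : ℝ) 2) {D : E → ℂ}
    {R : ℝ} (hmem : MemLp ((Metric.ball (0 : E) R).indicator fun s =>
      (‖s‖ ^ (((Module.finrank ℝ E : ℝ) + α) / 2)) • D s) 2) (v : E) :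
    inner ℝ hmem.toLp (kernelLp hα v) =
      ∫ s in Metric.ball (0 : E) R, inner ℝ (D s) (Complex.exp (inner ℝ v s * Complex.I) - 1) := by
  rw [L2.inner_def, ← integral_indicator measurableSet_ball]
  refine integral_congr_ae ?_
  have hne : ∀ᵐ s : E, s ≠ 0 := by simp [ae_iff, measure_singleton]
  filter_upwards [hmem.coeFn_toLp, (memLp_kernelFun hα v).coeFn_toLp, hne] with s h1 h2 h3
  rw [kernelLp, h1, h2]
  by_cases hs : s ∈ Metric.ball (0 : E) R
  · have hs' : 0 < ‖s‖ := norm_pos_iff.2 h3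
    rw [Set.indicator_of_mem hs, Set.indicator_of_mem hs, kernelFun, real_inner_smul_left,
      real_inner_smul_right, ← mul_assoc, ← Real.rpow_add hs']
    rw [show ((Module.finrank ℝ E : ℝ) + α) / 2 + -((Module.finrank ℝ E : ℝ) + α) / 2 = 0 by ring,
      Real.rpow_zero, one_mul]
  · rw [Set.indicator_of_notMem hs, Set.indicator_of_notMem hs, inner_zero_left]

lemma integral_setIntegral_inner_exp {D : E → ℂ} (hD : Continuous D) {C : ℝ}
    (hC : ∀ s, ‖D s‖ ≤ C) (R : ℝ) (F : Measure E) [IsProbabilityMeasure F] :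
    ∫ v, (∫ s in Metric.ball (0 : E) R,
        inner ℝ (D s) (Complex.exp (inner ℝ v s * Complex.I) - 1)) ∂F =
      ∫ s in Metric.ball (0 : E) R, inner ℝ (D s) (charFun F s - 1) := by
  have : IsFiniteMeasure (volume.restrict (Metric.ball (0 : E) R)) :=
    ⟨by rw [Measure.restrict_apply_univ]; exact measure_ball_lt_top⟩
  have h_int : ∀ s : E, Integrable (fun v : E => Complex.exp (inner ℝ v s * Complex.I)) F := by
    intro s
    refine Integrable.of_bound (C := 1) (by fun_prop) (Eventually.of_forall fun v => ?_)
    rw [Complex.norm_exp_ofReal_mul_I]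
  rw [integral_integral_swap]
  · refine integral_congr_ae (Eventually.of_forall fun s => ?_)
    simp only
    rw [integral_inner (f := fun v : E => Complex.exp (inner ℝ v s * Complex.I) - 1)
      ((h_int s).sub (integrable_const 1)), integral_sub (h_int s)
      (integrable_const 1), charFun_apply]
    simp
  · refine Integrable.of_bound (C := C * 2) ?_ (Eventually.of_forall fun z => ?_)
    · refine Continuous.aestronglyMeasurable ?_
      simp only [Function.uncurry_def]
      fun_prop
    · refine (norm_inner_le_norm _ _).trans
        (mul_le_mul (hC _) ?_ (norm_nonneg _) ((norm_nonneg _).trans (hC z.2)))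
      refine (norm_sub_le _ _).trans ?_
      rw [Complex.norm_exp_ofReal_mul_I, norm_one]; norm_num

/-- Let `D` be the difference of the characteristic functions. Testing the difference of the mean
embeddings against the weighted `D` gives, by Fubini, `∫ |D|²` over a ball. So `D` vanishes almost
everywhere, and everywhere by continuity. -/
lemma eq_of_integral_kernelLp_eq [Nontrivial E] {α : ℝ} (hα : α ∈ Set.Ioo (0 : ℝ) 2)
    {F G : Measure E} [IsProbabilityMeasure F] [IsProbabilityMeasure G]
    (hF : Integrable (kernelLp hα) F) (hG : Integrable (kernelLp hα) G)
    (h : ∫ v, kernelLp hα v ∂F = ∫ v, kernelLp hα v ∂G) : F = G := by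
  refine Measure.ext_of_charFun ?_
  set D : E → ℂ := fun s => charFun F s - charFun G s with hDdef
  have hD : Continuous D := continuous_charFun.sub continuous_charFun
  have hC : ∀ s, ‖D s‖ ≤ 2 := fun s => (norm_sub_le _ _).trans
    (by linarith [norm_charFun_le_one (μ := F) s, norm_charFun_le_one (μ := G) s])
  have hball : ∀ R : ℝ, ∀ᵐ s ∂(volume.restrict (Metric.ball (0 : E) R)), ‖D s‖ ^ 2 = 0 := by
    intro R
    have : IsFiniteMeasure (volume.restrict (Metric.ball (0 : E) R)) :=
      ⟨by rw [Measure.restrict_apply_univ]; exact measure_ball_lt_top⟩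
    have hmem := memLp_indicator_ball_rpow_smul hD hC
      (a := ((Module.finrank ℝ E : ℝ) + α) / 2)
      (by have := hα.1; positivity) R
    have hi : ∀ F : Measure E, IsProbabilityMeasure F →
        Integrable (fun s => inner ℝ (D s) (charFun F s - 1))
        (volume.restrict (Metric.ball (0 : E) R)) := by
      intro F hF
      refine Integrable.of_bound (C := 2 * 2) ?_ (Eventually.of_forall fun s => ?_)
      · exact (hD.inner (continuous_charFun.sub continuous_const)).aestronglyMeasurable
      · refine (norm_inner_le_norm _ _).trans (mul_le_mul (hC _) ?_ (norm_nonneg _) (by norm_num))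
        rw [norm_sub_rev]; exact norm_one_sub_charFun_le_two
    have hF1 := integral_inner hF hmem.toLp (𝕜 := ℝ)
    have hG1 := integral_inner hG hmem.toLp (𝕜 := ℝ)
    simp_rw [inner_toLp_kernelLp] at hF1 hG1
    rw [integral_setIntegral_inner_exp hD hC] at hF1 hG1
    have h0 : ∫ s in Metric.ball (0 : E) R, ‖D s‖ ^ 2 = 0 := by
      rw [← sub_eq_zero.2 (hF1.trans ((congrArg _ h).trans hG1.symm)),
        ← integral_sub (hi F ‹_›) (hi G ‹_›)]
      refine integral_congr_ae (Eventually.of_forall fun s => ?_)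
      simp only
      rw [← inner_sub_right, sub_sub_sub_cancel_right, ← real_inner_self_eq_norm_sq]
    refine (integral_eq_zero_iff_of_nonneg (fun _ => by positivity) ?_).1 h0
    refine Integrable.of_bound (C := 2 ^ 2) (hD.norm.pow 2).aestronglyMeasurable
      (Eventually.of_forall fun s => ?_)
    rw [Real.norm_of_nonneg (by positivity)]
    exact pow_le_pow_left₀ (norm_nonneg _) (hC s) 2
  have hae : D =ᵐ[volume] fun _ => 0 := by
    have h1 : ∀ᵐ s : E, ∀ n : ℕ, s ∈ Metric.ball (0 : E) n → ‖D s‖ ^ 2 = 0 :=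
      ae_all_iff.2 fun n => (ae_restrict_iff' measurableSet_ball).1 (hball n)
    filter_upwards [h1] with s hs
    obtain ⟨n, hn⟩ := exists_nat_gt ‖s‖
    simpa using hs n (mem_ball_zero_iff.2 hn)
  have h2 := (Continuous.ae_eq_iff_eq volume hD continuous_const).1 hae
  ext s
  exact sub_eq_zero.1 (congrFun h2 s)

/-- Powers of the Euclidean distance are squared distances in a Hilbert space, with an embedding
whose mean determines a probability measure. -/
theorem exists_hilbert_embedding [Nontrivial E] {α : ℝ} (hα : α ∈ Set.Ioo (0 : ℝ) 2) :
    ∃ Φ : E → Lp ℂ 2 (volume : Measure E), Φ 0 = 0 ∧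
      (∀ v w, ‖Φ v - Φ w‖ ^ 2 = ‖v - w‖ ^ α) ∧
      ∀ F G : Measure E, IsProbabilityMeasure F → IsProbabilityMeasure G →
        Integrable Φ F → Integrable Φ G → ∫ v, Φ v ∂F = ∫ v, Φ v ∂G → F = G := by
  obtain ⟨e, he⟩ := exists_norm_eq E (zero_le_one' ℝ)
  have hpos := kernelNormSq_pos hα he
  set c : ℝ := (√(kernelNormSq α e))⁻¹ with hc
  have hc0 : c ≠ 0 := by positivity
  refine ⟨fun v => c • kernelLp hα v, ?_, fun v w => ?_, fun F G _ _ hF hG h => ?_⟩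
  · simp only [kernelLp_zero, smul_zero]
  · rw [← smul_sub, norm_smul, mul_pow, norm_kernelLp_sub_sq, kernelNormSq_eq hα.1 he, hc,
      norm_inv, inv_pow, Real.norm_of_nonneg (Real.sqrt_nonneg _), Real.sq_sqrt hpos.le]
    field_simp
  · rw [integral_smul, integral_smul] at h
    exact eq_of_integral_kernelLp_eq hα ((integrable_smul_iff hc0 _).1 hF)
      ((integrable_smul_iff hc0 _).1 hG) (smul_right_injective _ hc0 h)

/-- A probability measure `G` with `μ ∗ G = μ` for some probability measure `μ` is concentrated
at `0`. -/
theorem ae_eq_zero_of_conv_eq_self {μ G : Measure E} [IsProbabilityMeasure μ]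
    [IsProbabilityMeasure G] (h : μ ∗ G = μ) : ∀ᵐ z ∂G, z = 0 := by
  -- A characteristic function equals `1` at `0`, so near `0` it can be cancelled from `charFun μ *
  -- charFun G = charFun μ`.
  have hcont : ∀ᶠ s in 𝓝 (0 : E), charFun μ s ≠ 0 :=
    (continuous_charFun (μ := μ)).continuousAt.eventually_ne (by simp)
  obtain ⟨r, hr, hball⟩ := Metric.eventually_nhds_iff.1 hcont
  have hone : ∀ s : E, ‖s‖ < r → charFun G s = 1 := by
    intro s hs
    have h1 := charFun_conv (μ := μ) (ν := G) s
    rw [h] at h1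
    exact (mul_eq_left₀ (hball (by simpa using hs))).1 h1.symm
  have hcos : ∀ s : E, ‖s‖ < r → ∀ᵐ z ∂G, Real.cos (inner ℝ z s) = 1 := by
    intro s hs
    have hi : Integrable (fun z : E => Complex.exp (inner ℝ z s * Complex.I)) G := by
      refine Integrable.of_bound (C := 1) (by fun_prop) (Eventually.of_forall fun v => ?_)
      rw [Complex.norm_exp_ofReal_mul_I]
    have hre : (fun z : E => (Complex.exp (inner ℝ z s * Complex.I)).re) =
        fun z => Real.cos (inner ℝ z s) := by
      ext z; exact Complex.exp_ofReal_mul_I_re _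
    have hi' : Integrable (fun z : E => Real.cos (inner ℝ z s)) G := hre ▸ hi.re
    have h2 : ∫ z, (1 - Real.cos (inner ℝ z s)) ∂G = 0 := by
      rw [integral_sub (integrable_const _) hi', ← hre]
      have h3 : ∫ z, (Complex.exp (inner ℝ z s * Complex.I)).re ∂G = (charFun G s).re := by
        rw [charFun_apply]; exact integral_re hi
      rw [h3, hone s hs]; simp
    have h4 := (integral_eq_zero_iff_of_nonneg (fun z => sub_nonneg.2 (Real.cos_le_one _))
      ((integrable_const _).sub hi')).1 h2
    filter_upwards [h4] with z hz
    exact (sub_eq_zero.1 hz).symm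
  have hzero : ∀ s : E, ‖s‖ < r → ∀ᵐ z ∂G, inner ℝ z s = 0 := by
    intro s hs
    -- `cos = 1` at `s` alone only places `⟨z,s⟩` in `2πℤ`. Shrinking `s` until the inner product is
    -- below `1` in modulus leaves only the value `0`.
    have hn : ∀ᵐ z ∂G, ∀ n : ℕ, Real.cos (inner ℝ z (((n : ℝ) + 1)⁻¹ • s)) = 1 := by
      refine ae_all_iff.2 fun n => hcos _ ?_
      rw [norm_smul, norm_inv, Real.norm_of_nonneg (by positivity)]
      refine lt_of_le_of_lt (mul_le_of_le_one_left (norm_nonneg _) (inv_le_one_of_one_le₀ ?_)) hs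
      linarith [Nat.cast_nonneg (α := ℝ) n]
    filter_upwards [hn] with z hz
    obtain ⟨n, hn⟩ := exists_nat_gt |inner ℝ z s|
    have h1 := hz n
    have hn1 : (0 : ℝ) < n + 1 := by positivity
    have habs : |(n + 1 : ℝ)⁻¹ * inner ℝ z s| < 1 := by
      rw [abs_mul, abs_of_pos (inv_pos.2 hn1), inv_mul_lt_iff₀ hn1]; linarith
    rw [abs_lt] at habs
    rw [real_inner_smul_right, Real.cos_eq_one_iff_of_lt_of_lt (by linarith [Real.pi_gt_three])
      (by linarith [Real.pi_gt_three])] at h1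
    exact (mul_eq_zero.1 h1).resolve_left (by positivity)
  have hall : ∀ᵐ z ∂G, ∀ i, inner ℝ z ((r / 2) • stdOrthonormalBasis ℝ E i) = 0 := by
    refine ae_all_iff.2 fun i => hzero _ ?_
    rw [norm_smul, (stdOrthonormalBasis ℝ E).norm_eq_one, Real.norm_of_nonneg (by positivity)]
    linarith
  filter_upwards [hall] with z hz
  rw [← (stdOrthonormalBasis ℝ E).sum_repr' z]
  refine Finset.sum_eq_zero fun i _ => ?_
  have := hz i
  rw [real_inner_smul_right] at this
  rw [real_inner_comm, (mul_eq_zero.1 this).resolve_left (by positivity), zero_smul]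

end Embedding

/-! ### Energy distances as squared distances of averages in Hilbert space. -/

section PowerEmbedding

variable {q : ℕ} {H : Type*} [NormedAddCommGroup H] [InnerProductSpace ℝ H]

/-- A map into a Hilbert space for which the squared distance of the images is the `α`-th power of
the Euclidean distance. -/
structure IsPowerEmbedding (α : ℝ) (Φ : Vec q → H) : Prop where
  map_zero : Φ 0 = 0
  norm_sub_sq : ∀ v w, ‖Φ v - Φ w‖ ^ 2 = ‖v - w‖ ^ α

lemma IsPowerEmbedding.norm_sq {α : ℝ} {Φ : Vec q → H} (hΦ : IsPowerEmbedding α Φ) (v : Vec q) :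
    ‖Φ v‖ ^ 2 = ‖v‖ ^ α := by
  simpa [hΦ.map_zero] using hΦ.norm_sub_sq v 0

lemma IsPowerEmbedding.norm_sub {α : ℝ} {Φ : Vec q → H} (hΦ : IsPowerEmbedding α Φ)
    (v w : Vec q) : ‖Φ v - Φ w‖ = ‖v - w‖ ^ (α / 2) := by
  rw [← Real.sqrt_sq (norm_nonneg (Φ v - Φ w)), hΦ.norm_sub_sq, Real.sqrt_eq_rpow,
    ← Real.rpow_mul (norm_nonneg _)]
  congr 1; ring

lemma IsPowerEmbedding.continuous {α : ℝ} {Φ : Vec q → H} (hΦ : IsPowerEmbedding α Φ)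
    (hα : 0 < α) : Continuous Φ := by
  refine continuous_iff_continuousAt.2 fun v => ?_
  rw [ContinuousAt, tendsto_iff_norm_sub_tendsto_zero]
  simp_rw [hΦ.norm_sub]
  have h : Continuous fun w : Vec q => ‖w - v‖ ^ (α / 2) :=
    (by fun_prop : Continuous fun w : Vec q => ‖w - v‖).rpow_const fun _ => Or.inr (by positivity)
  have h0 := h.tendsto v
  simpa [Real.zero_rpow (by positivity : α / 2 ≠ 0)] using h0

/-- The average of a family of vectors over a finite set of indices. -/
def avg (A : Finset ℕ) (a : ℕ → H) : H := (A.card : ℝ)⁻¹ • ∑ i ∈ A, a i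

lemma sum_sum_norm_sub_sq (A B : Finset ℕ) (a b : ℕ → H) :
    ∑ i ∈ A, ∑ j ∈ B, ‖a i - b j‖ ^ 2 =
      B.card * ∑ i ∈ A, ‖a i‖ ^ 2 + A.card * ∑ j ∈ B, ‖b j‖ ^ 2
        - 2 * inner ℝ (∑ i ∈ A, a i) (∑ j ∈ B, b j) := by
  simp_rw [norm_sub_sq_real, sum_inner, inner_sum, Finset.sum_add_distrib, Finset.sum_sub_distrib,
    Finset.sum_const, nsmul_eq_mul, Finset.mul_sum]
  ring

lemma sum_sum_filter_lt_of_symm (A : Finset ℕ) {f : ℕ → ℕ → ℝ} (hs : ∀ i j, f i j = f j i)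
    (h0 : ∀ i, f i i = 0) :
    ∑ i ∈ A, ∑ j ∈ A, f i j = 2 * ∑ i ∈ A, ∑ j ∈ A with i < j, f i j := by
  have h1 : ∀ i j, f i j = (if i < j then f i j else 0) + (if j < i then f i j else 0) := by
    intro i j
    rcases lt_trichotomy i j with h | h | h
    · simp [h, h.le]
    · subst h; simp [h0]
    · simp [h, h.le]
  have h2 : ∑ i ∈ A, ∑ j ∈ A, (if j < i then f i j else 0) =
      ∑ i ∈ A, ∑ j ∈ A, (if i < j then f i j else 0) := by
    rw [Finset.sum_comm]
    refine Finset.sum_congr rfl fun i _ => Finset.sum_congr rfl fun j _ => ?_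
    rw [hs]
  calc _ = ∑ i ∈ A, ∑ j ∈ A, ((if i < j then f i j else 0) + (if j < i then f i j else 0)) :=
        Finset.sum_congr rfl fun i _ => Finset.sum_congr rfl fun j _ => h1 i j
    _ = _ := by
        simp_rw [Finset.sum_add_distrib, h2, Finset.sum_filter]; ring

/-- The diagonal terms vanish, so both sides have the same sum, normalized by `n(n-1)` instead of
`n²`, and `n/(n-1) = 1 + 1/(n-1)`. -/
lemma meanWithin_eq {α : ℝ} (hα : 0 < α) {A : Finset ℕ} (hA : 2 ≤ A.card) (v : ℕ → Vec q) :
    meanWithin α A v = meanBetween α A A v v + meanBetween α A A v v / (A.card - 1) := by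
  have hn : (2 : ℝ) ≤ A.card := by exact_mod_cast hA
  have h := sum_sum_filter_lt_of_symm A (f := fun i j => ‖v i - v j‖ ^ α)
    (fun i j => by rw [norm_sub_rev]) (fun i => by simp [Real.zero_rpow hα.ne'])
  rw [meanWithin, meanBetween, h, Nat.cast_choose_two]
  have h1 : (A.card : ℝ) - 1 ≠ 0 := by linarith
  field_simp
  ring

lemma meanBetween_nonneg (α : ℝ) (A B : Finset ℕ) (v w : ℕ → Vec q) :
    0 ≤ meanBetween α A B v w := by
  unfold meanBetween; positivity

variable {α : ℝ} {Φ : Vec q → H}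

lemma IsPowerEmbedding.meanBetween_eq (hΦ : IsPowerEmbedding α Φ) {A B : Finset ℕ}
    (hA : A.Nonempty) (hB : B.Nonempty) (v w : ℕ → Vec q) :
    meanBetween α A B v w = (A.card : ℝ)⁻¹ * ∑ i ∈ A, ‖v i‖ ^ α +
      (B.card : ℝ)⁻¹ * ∑ i ∈ B, ‖w i‖ ^ α -
      2 * inner ℝ (avg A fun i => Φ (v i)) (avg B fun i => Φ (w i)) := by
  have hA' : (A.card : ℝ) ≠ 0 := by exact_mod_cast hA.card_pos.ne'
  have hB' : (B.card : ℝ) ≠ 0 := by exact_mod_cast hB.card_pos.ne'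
  simp_rw [meanBetween, ← hΦ.norm_sub_sq]
  rw [sum_sum_norm_sub_sq, avg, avg, real_inner_smul_left, real_inner_smul_right]
  simp_rw [hΦ.norm_sq]
  field_simp

/-- The average moments cancel, and the remaining inner products of averages form a complete square.
-/
lemma IsPowerEmbedding.two_mul_meanBetween_sub (hΦ : IsPowerEmbedding α Φ) {A B : Finset ℕ}
    (hA : A.Nonempty) (hB : B.Nonempty) (v w : ℕ → Vec q) :
    2 * meanBetween α A B v w - meanBetween α A A v v - meanBetween α B B w w =
      2 * ‖avg A (fun i => Φ (v i)) - avg B (fun i => Φ (w i))‖ ^ 2 := by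
  rw [hΦ.meanBetween_eq hA hB, hΦ.meanBetween_eq hA hA, hΦ.meanBetween_eq hB hB, norm_sub_sq_real,
    real_inner_self_eq_norm_sq, real_inner_self_eq_norm_sq]
  ring

lemma IsPowerEmbedding.meanBetween_self_le (hΦ : IsPowerEmbedding α Φ) {A : Finset ℕ}
    (hA : A.Nonempty) (v : ℕ → Vec q) :
    meanBetween α A A v v ≤ 2 * ((A.card : ℝ)⁻¹ * ∑ i ∈ A, ‖v i‖ ^ α) := by
  rw [hΦ.meanBetween_eq hA hA, real_inner_self_eq_norm_sq]
  nlinarith [sq_nonneg ‖avg A fun i => Φ (v i)‖]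

end PowerEmbedding

/-! ### Moment bounds. -/

section Moments

lemma add_rpow_le {α : ℝ} (hα : α ∈ Set.Ioo (0 : ℝ) 2) {a b : ℝ} (ha : 0 ≤ a) (hb : 0 ≤ b) :
    (a + b) ^ α ≤ 4 * (a ^ α + b ^ α) := by
  wlog hab : a ≤ b generalizing a b
  · rw [add_comm a, add_comm (a ^ α)]; exact this hb ha (le_of_not_ge hab)
  have h4 : (2 : ℝ) ^ α ≤ 4 := by
    calc (2 : ℝ) ^ α ≤ 2 ^ (2 : ℝ) := Real.rpow_le_rpow_of_exponent_le (by norm_num) hα.2.le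
      _ = 4 := by norm_num
  calc (a + b) ^ α ≤ (2 * b) ^ α := Real.rpow_le_rpow (by positivity) (by linarith) hα.1.le
    _ = 2 ^ α * b ^ α := Real.mul_rpow (by norm_num) hb
    _ ≤ 4 * b ^ α := by gcongr
    _ ≤ _ := by have := Real.rpow_nonneg ha α; linarith

lemma integrable_norm_rpow_of_two_mul {V : Type*} [NormedAddCommGroup V] [MeasurableSpace V]
    [OpensMeasurableSpace V] {α : ℝ} {μ : Measure V} [IsFiniteMeasure μ]
    (h : Integrable (fun z => ‖z‖ ^ (2 * α)) μ) : Integrable (fun z => ‖z‖ ^ α) μ := by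
  refine Integrable.mono' ((integrable_const (1 : ℝ)).add h)
    (measurable_norm.pow_const α).aestronglyMeasurable (Eventually.of_forall fun z => ?_)
  rw [Real.norm_of_nonneg (by positivity), Pi.add_apply]
  have : ‖z‖ ^ (2 * α) = (‖z‖ ^ α) ^ 2 := by
    rw [← Real.rpow_natCast, ← Real.rpow_mul (norm_nonneg _)]; congr 1; push_cast; ring
  rw [this]
  nlinarith [sq_nonneg (‖z‖ ^ α - 1)]

lemma norm_add_apply_rpow_le {p q : ℕ} {α : ℝ} (hα : α ∈ Set.Ioo (0 : ℝ) 2) (c : Coef p q)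
    (u : Vec q) (x : Vec p) :
    ‖u + c x‖ ^ α ≤ 4 * (1 + ‖c‖ ^ α) * (‖u‖ ^ α + ‖x‖ ^ α) := by
  have h1 : ‖u + c x‖ ^ α ≤ (‖u‖ + ‖c‖ * ‖x‖) ^ α :=
    Real.rpow_le_rpow (norm_nonneg _)
      ((norm_add_le _ _).trans (by gcongr; exact c.le_opNorm x)) hα.1.le
  have h2 := add_rpow_le hα (norm_nonneg u) (by positivity : 0 ≤ ‖c‖ * ‖x‖)
  rw [Real.mul_rpow (norm_nonneg _) (norm_nonneg _)] at h2
  have h3 : 0 ≤ ‖u‖ ^ α := by positivity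
  have h4 : 0 ≤ ‖x‖ ^ α := by positivity
  have h5 : 0 ≤ ‖c‖ ^ α := by positivity
  nlinarith [mul_nonneg h5 h3]

end Moments

/-! ### Variances of sums in Hilbert space. -/

section SecondMoment

variable {H : Type*} [NormedAddCommGroup H] [InnerProductSpace ℝ H] [CompleteSpace H]

/-- For two independent copies, the mean squared distance is twice the variance. -/
lemma integral_norm_sub_sq_prod {Z : Type*} [MeasurableSpace Z] {κ : Measure Z}
    [IsProbabilityMeasure κ] {g : Z → H} (hg : MemLp g 2 κ) :
    ∫ z, ‖g z.1 - g z.2‖ ^ 2 ∂(κ.prod κ) = 2 * ∫ z, ‖g z - ∫ z', g z' ∂κ‖ ^ 2 ∂κ := by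
  set M := ∫ z', g z' ∂κ with hM
  have hf : MemLp (fun z => g z - M) 2 κ := hg.sub (memLp_const M)
  set f : Z → H := fun z => g z - M with hfdef
  have hf1 : Integrable f κ := hf.integrable one_le_two
  have hf0 : ∫ z, f z ∂κ = 0 := by
    rw [hfdef, integral_sub (hg.integrable one_le_two) (integrable_const M)]; simp [hM]
  have hfst : MemLp (fun z : Z × Z => f z.1) 2 (κ.prod κ) :=
    hf.comp_measurePreserving measurePreserving_fst
  have hsnd : MemLp (fun z : Z × Z => f z.2) 2 (κ.prod κ) :=
    hf.comp_measurePreserving measurePreserving_snd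
  have h1 : Integrable (fun z : Z × Z => ‖f z.1‖ ^ 2) (κ.prod κ) :=
    (memLp_two_iff_integrable_sq_norm hfst.1).1 hfst
  have h2 : Integrable (fun z : Z × Z => ‖f z.2‖ ^ 2) (κ.prod κ) :=
    (memLp_two_iff_integrable_sq_norm hsnd.1).1 hsnd
  have h3 : Integrable (fun z : Z × Z => inner ℝ (f z.1) (f z.2)) (κ.prod κ) := by
    refine Integrable.mono' (h1.add h2) (hfst.1.inner hsnd.1) (Eventually.of_forall fun z => ?_)
    refine (norm_inner_le_norm _ _).trans ?_
    simp only [Pi.add_apply]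
    nlinarith [sq_nonneg (‖f z.1‖ - ‖f z.2‖), sq_nonneg (‖f z.1‖), sq_nonneg (‖f z.2‖)]
  have hexp : ∀ z : Z × Z, ‖g z.1 - g z.2‖ ^ 2 =
      ‖f z.1‖ ^ 2 - 2 * inner ℝ (f z.1) (f z.2) + ‖f z.2‖ ^ 2 := by
    intro z
    rw [← norm_sub_sq_real, hfdef]; simp
  simp_rw [hexp]
  rw [integral_add (by exact h1.sub (h3.const_mul 2)) h2, integral_sub h1 (h3.const_mul 2),
    integral_const_mul, integral_prod _ h3]
  simp_rw [integral_inner hf1, hf0, inner_zero_right, integral_zero]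
  have e1 : ∫ z : Z × Z, ‖f z.1‖ ^ 2 ∂(κ.prod κ) = ∫ z, ‖f z‖ ^ 2 ∂κ := by
    rw [integral_fun_fst (fun z => ‖f z‖ ^ 2)]; simp
  have e2 : ∫ z : Z × Z, ‖f z.2‖ ^ 2 ∂(κ.prod κ) = ∫ z, ‖f z‖ ^ 2 ∂κ := by
    rw [integral_fun_snd (fun z => ‖f z‖ ^ 2)]; simp
  rw [e1, e2]; ring

/-- Interchanging the two middle factors of a fourfold product. -/
lemma measurePreserving_prod_prod_comm {A B C D : Type*} [MeasurableSpace A] [MeasurableSpace B]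
    [MeasurableSpace C] [MeasurableSpace D] (a : Measure A) (b : Measure B) (c : Measure C)
    (d : Measure D) [SFinite a] [SFinite b] [SFinite c] [SFinite d] :
    MeasurePreserving (fun z : (A × B) × (C × D) => ((z.1.1, z.2.1), (z.1.2, z.2.2)))
      ((a.prod b).prod (c.prod d)) ((a.prod c).prod (b.prod d)) := by
  have e1 := measurePreserving_prodAssoc a b (c.prod d)
  have e2 := (MeasurePreserving.id a).prod (measurePreserving_prodAssoc b c d).symm
  have e3 := (MeasurePreserving.id a).prod
    ((Measure.measurePreserving_swap (μ := b) (ν := c)).prod (MeasurePreserving.id d))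
  have e4 := (MeasurePreserving.id a).prod (measurePreserving_prodAssoc c b d)
  have e5 := (measurePreserving_prodAssoc a c (b.prod d)).symm
  exact e5.comp (e4.comp (e3.comp (e2.comp e1)))

lemma card_filter_abs_sub_lt_le (A : Finset ℕ) (N s : ℕ) :
    (A.filter fun t : ℕ => |(s : ℤ) - (t : ℤ)| < N).card ≤ 2 * N := by
  calc _ ≤ (Finset.Ioo (s - N : ℤ) (s + N)).card := by
        refine Finset.card_le_card_of_injOn (fun t : ℕ => (t : ℤ)) (fun t ht => ?_)
          (fun x _ y _ h => by simpa using h)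
        simp only [Finset.coe_filter, Set.mem_ofPred_eq] at ht
        simp only [Finset.coe_Ioo, Set.mem_Ioo]
        have := abs_lt.1 ht.2
        omega
    _ ≤ _ := by rw [Int.card_Ioo]; omega

/-- The variance of a sum of vectors that are nearly uncorrelated at distance at least `N`. -/
lemma integral_norm_sum_sq_le {Ω : Type*} [MeasurableSpace Ω] {P : Measure Ω}
    {f : ℕ → Ω → H} {A : Finset ℕ} (hf : ∀ t ∈ A, MemLp (f t) 2 P) {K δ : ℝ} (hδ : 0 ≤ δ)
    (hK : ∀ t ∈ A, ∫ ω, ‖f t ω‖ ^ 2 ∂P ≤ K) (N : ℕ)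
    (hN : ∀ s ∈ A, ∀ t ∈ A, (N : ℤ) ≤ |(s : ℤ) - (t : ℤ)| →
      ∫ ω, inner ℝ (f s ω) (f t ω) ∂P ≤ δ) :
    ∫ ω, ‖∑ t ∈ A, f t ω‖ ^ 2 ∂P ≤ δ * A.card ^ 2 + 2 * N * K * A.card := by
  have hsq : ∀ t ∈ A, Integrable (fun ω => ‖f t ω‖ ^ 2) P := fun t ht =>
    (memLp_two_iff_integrable_sq_norm (hf t ht).1).1 (hf t ht)
  have h_int : ∀ s ∈ A, ∀ t ∈ A, Integrable (fun ω => inner ℝ (f s ω) (f t ω)) P := by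
    intro s hs t ht
    refine Integrable.mono' ((hsq s hs).add (hsq t ht)) ((hf s hs).1.inner (hf t ht).1)
      (Eventually.of_forall fun ω => ?_)
    refine (norm_inner_le_norm _ _).trans ?_
    simp only [Pi.add_apply]
    nlinarith [sq_nonneg (‖f s ω‖ - ‖f t ω‖), sq_nonneg (‖f s ω‖), sq_nonneg (‖f t ω‖)]
  -- Bound for the pairs closer than `N`, about which `hN` says nothing.
  have hle : ∀ s ∈ A, ∀ t ∈ A, ∫ ω, inner ℝ (f s ω) (f t ω) ∂P ≤ K := by
    intro s hs t ht
    have h1 : ∫ ω, inner ℝ (f s ω) (f t ω) ∂P ≤ ∫ ω, (‖f s ω‖ ^ 2 + ‖f t ω‖ ^ 2) / 2 ∂P := by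
      refine integral_mono (h_int s hs t ht) (((hsq s hs).add (hsq t ht)).div_const 2) fun ω => ?_
      have := real_inner_le_norm (f s ω) (f t ω)
      simp only
      nlinarith [sq_nonneg (‖f s ω‖ - ‖f t ω‖)]
    rw [integral_div, integral_add (hsq s hs) (hsq t ht)] at h1
    linarith [hK s hs, hK t ht]
  have hexp : ∀ ω, ‖∑ t ∈ A, f t ω‖ ^ 2 = ∑ s ∈ A, ∑ t ∈ A, inner ℝ (f s ω) (f t ω) := by
    intro ω
    simp_rw [← real_inner_self_eq_norm_sq, sum_inner, inner_sum]
  simp_rw [hexp]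
  rw [integral_finsetSum _ fun s hs => integrable_finsetSum _ fun t ht => h_int s hs t ht]
  -- For fixed `s`, at most `2N` indices are closer than `N` and cost up to `K` each; every other
  -- one costs at most `δ`.
  have hrow : ∀ s ∈ A, ∫ ω, ∑ t ∈ A, inner ℝ (f s ω) (f t ω) ∂P ≤ δ * A.card + 2 * N * K := by
    intro s hs
    have hK0 : 0 ≤ K := (integral_nonneg fun _ => by positivity).trans (hK s hs)
    rw [integral_finsetSum _ fun t ht => h_int s hs t ht]
    calc _ ≤ ∑ t ∈ A, (δ + if |(s : ℤ) - (t : ℤ)| < N then K else 0) := by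
          refine Finset.sum_le_sum fun t ht => ?_
          split_ifs with h
          · linarith [hle s hs t ht]
          · rw [add_zero]; exact hN s hs t ht (not_lt.1 h)
      _ = A.card * δ + (A.filter fun t : ℕ => |(s : ℤ) - (t : ℤ)| < N).card * K := by
          rw [Finset.sum_add_distrib, ← Finset.sum_filter, Finset.sum_const, Finset.sum_const,
            nsmul_eq_mul, nsmul_eq_mul]
      _ ≤ A.card * δ + ((2 * N : ℕ) : ℝ) * K := by
          gcongr; exact card_filter_abs_sub_lt_le A N s
      _ = _ := by push_cast; ring
  calc _ ≤ ∑ s ∈ A, (δ * A.card + 2 * N * K) := Finset.sum_le_sum hrow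
    _ = _ := by rw [Finset.sum_const, nsmul_eq_mul]; ring

end SecondMoment

/-! ### The true partition. -/

section TruePartition

variable {k : ℕ} {lam0 : Fin (k + 2) → ℝ}

lemma trueCP_mono (h1 : A1 lam0) (T : ℕ) : Monotone (trueCP lam0 T) := fun _ _ hij =>
  Nat.floor_mono (mul_le_mul_of_nonneg_left (h1.1.monotone hij) (Nat.cast_nonneg T))

lemma trueCP_zero (h1 : A1 lam0) (T : ℕ) : trueCP lam0 T 0 = 0 := by
  simp [trueCP, h1.2.1]

lemma trueCP_last (h1 : A1 lam0) (T : ℕ) : trueCP lam0 T (Fin.last (k + 1)) = T := by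
  simp [trueCP, h1.2.2]

lemma block_subset_Icc {τ : Fin (k + 2) → ℕ} {T : ℕ} (hτ : Monotone τ)
    (hT : τ (Fin.last (k + 1)) = T) (i : Fin (k + 1)) : block τ i ⊆ Finset.Icc 1 T := by
  intro t ht
  rw [block, Finset.mem_Ioc] at ht
  rw [Finset.mem_Icc, ← hT]
  exact ⟨by omega, ht.2.trans (hτ (Fin.le_last _))⟩

lemma sum_sum_Ioc_eq {M : Type*} [AddCommMonoid M] (f : ℕ → M) : ∀ {n : ℕ} {τ : Fin (n + 1) → ℕ},
    Monotone τ → ∑ i : Fin n, ∑ t ∈ Finset.Ioc (τ i.castSucc) (τ i.succ), f t =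
      ∑ t ∈ Finset.Ioc (τ 0) (τ (Fin.last n)), f t := by
  intro n
  induction n with
  | zero => intro τ _; simp
  | succ n ih =>
    intro τ hτ
    have h := ih (τ := fun i => τ i.castSucc)
      (fun i j hij => hτ (Fin.castSucc_le_castSucc_iff.2 hij))
    rw [Fin.sum_univ_castSucc]
    simp only [Fin.succ_castSucc, Fin.succ_last] at h ⊢
    rw [h]
    exact Finset.sum_Ioc_consecutive f (hτ (Fin.zero_le _)) (hτ (Fin.le_last _))

lemma tendsto_floor_mul_div (a : ℝ) (ha : 0 ≤ a) :
    Tendsto (fun T : ℕ => (⌊(T : ℝ) * a⌋₊ : ℝ) / T) atTop (𝓝 a) := by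
  have := (tendsto_nat_floor_mul_div_atTop (R := ℝ) ha).comp tendsto_natCast_atTop_atTop
  refine this.congr fun T => ?_
  simp [mul_comm]

lemma nonneg_of_A1 (h1 : A1 lam0) (j : Fin (k + 2)) : 0 ≤ lam0 j := by
  rw [← h1.2.1]; exact h1.1.monotone (Fin.zero_le _)

lemma tendsto_trueCP_div (h1 : A1 lam0) (j : Fin (k + 2)) :
    Tendsto (fun T : ℕ => (trueCP lam0 T j : ℝ) / T) atTop (𝓝 (lam0 j)) :=
  tendsto_floor_mul_div _ (nonneg_of_A1 h1 j)

/-- The strict inequality in `hε` absorbs the rounding to integers. -/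
lemma eventually_isAdmissible_trueCP {ε : ℝ} (h1 : A1 lam0)
    (hε : ∀ i : Fin (k + 1), ε < lam0 i.succ - lam0 i.castSucc) :
    ∀ᶠ T in atTop, IsAdmissible ε T (trueCP lam0 T) := by
  have h : ∀ i : Fin (k + 1), ∀ᶠ T : ℕ in atTop,
      ε * (T : ℝ) ≤ (trueCP lam0 T i.succ : ℝ) - (trueCP lam0 T i.castSucc : ℝ) := by
    intro i
    have := ((tendsto_trueCP_div h1 i.succ).sub
      (tendsto_trueCP_div h1 i.castSucc)).eventually_const_lt (hε i)
    filter_upwards [this, eventually_gt_atTop 0] with T hT hT0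
    have hT0' : (0 : ℝ) < T := by exact_mod_cast hT0
    rw [← sub_div, lt_div_iff₀ hT0'] at hT
    exact hT.le
  filter_upwards [eventually_all.2 h] with T hT
  exact ⟨trueCP_zero h1 T, trueCP_last h1 T, hT⟩

lemma IsAdmissible.monotone {ε : ℝ} (hε : 0 < ε) {T : ℕ} {τ : Fin (k + 2) → ℕ}
    (h : IsAdmissible ε T τ) : Monotone τ := by
  refine Fin.monotone_iff_le_succ.2 fun i => ?_
  have h1 := h.2.2 i
  have : (τ i.castSucc : ℝ) ≤ τ i.succ := by nlinarith [Nat.cast_nonneg (α := ℝ) T]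
  exact_mod_cast this

/-- Ensures that `ν j` is the law of an actual regressor, and so a probability measure. -/
lemma eventually_mem_block_trueCP (h1 : A1 lam0) (j : Fin (k + 1)) :
    ∀ᶠ T : ℕ in atTop, trueCP lam0 T j.succ ∈ block (trueCP lam0 T) j := by
  have hlt : lam0 j.castSucc < lam0 j.succ := h1.1 (Fin.castSucc_lt_succ)
  filter_upwards [(tendsto_trueCP_div h1 j.castSucc).eventually_lt
    (tendsto_trueCP_div h1 j.succ) hlt,
    eventually_gt_atTop 0] with T hT hT0
  have hT0' : (0 : ℝ) < T := by exact_mod_cast hT0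
  rw [div_lt_div_iff_of_pos_right hT0'] at hT
  exact Finset.mem_Ioc.2 ⟨by exact_mod_cast hT, le_rfl⟩

end TruePartition

/-! ### Second moment bound for the embedded data. -/

section LawOfLargeNumbers

variable {Ω : Type*} [MeasurableSpace Ω] {P : Measure Ω} [IsProbabilityMeasure P] {k p q : ℕ}
  {α : ℝ} {lam0 : Fin (k + 2) → ℝ} {x : ℕ → ℕ → Ω → Vec p} {u : ℕ → ℕ → Ω → Vec q}
  {ν : Fin (k + 1) → Measure (Vec p)} {μ : Measure (Vec q)}

lemma A3.isProbabilityMeasure (h3 : A3 P α x u μ) : IsProbabilityMeasure μ := by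
  have h := h3.1 1 1 (by simp)
  rw [← h.map_eq]
  exact Measure.isProbabilityMeasure_map h.aemeasurable

lemma A2.isProbabilityMeasure (h1 : A1 lam0) (h2 : A2 P α lam0 x ν) (j : Fin (k + 1)) :
    IsProbabilityMeasure (ν j) := by
  obtain ⟨T, hT⟩ := (eventually_mem_block_trueCP h1 j).exists
  have h := h2.1 T j _ hT
  rw [← h.map_eq]
  exact Measure.isProbabilityMeasure_map h.aemeasurable

lemma hasLaw_prod_of_mem_block (h1 : A1 lam0) (h2 : A2 P α lam0 x ν) (h3 : A3 P α x u μ) {T : ℕ}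
    {j : Fin (k + 1)} {t : ℕ} (ht : t ∈ block (trueCP lam0 T) j) :
    HasLaw (fun ω => (u T t ω, x T t ω)) (μ.prod (ν j)) P := by
  have ht' := block_subset_Icc (trueCP_mono h1 T) (trueCP_last h1 T) j ht
  exact IndepFun.hasLaw_prod (h3.1 T t ht') (h2.1 T j t ht) (h3.2.2.1 T t ht' t ht')

variable {H : Type*} [NormedAddCommGroup H] [InnerProductSpace ℝ H] [CompleteSpace H]
  {Φ : Vec q → H}

/-- The mean embedding of the law of `U + c X` for independent `U ∼ μ` and `X ∼ ν`. -/
def popMean (Φ : Vec q → H) (μ : Measure (Vec q)) (ν : Measure (Vec p)) (c : Coef p q) : H :=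
  ∫ z, Φ (z.1 + c z.2) ∂(μ.prod ν)

lemma IsPowerEmbedding.memLp_prod (hΦ : IsPowerEmbedding α Φ) (hα : α ∈ Set.Ioo (0 : ℝ) 2)
    {ν : Measure (Vec p)} [IsProbabilityMeasure μ] [IsProbabilityMeasure ν]
    (hμ : Integrable (fun z => ‖z‖ ^ (2 * α)) μ) (hν : Integrable (fun z => ‖z‖ ^ (2 * α)) ν)
    (c : Coef p q) : MemLp (fun z : Vec q × Vec p => Φ (z.1 + c z.2)) 2 (μ.prod ν) := by
  have hcont : Continuous fun z : Vec q × Vec p => Φ (z.1 + c z.2) :=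
    (hΦ.continuous hα.1).comp (by fun_prop)
  rw [memLp_two_iff_integrable_sq_norm hcont.aestronglyMeasurable]
  have hu := (integrable_norm_rpow_of_two_mul hμ).comp_fst ν
  have hx := (integrable_norm_rpow_of_two_mul hν).comp_snd μ
  refine Integrable.mono' ((hu.add hx).const_mul (4 * (1 + ‖c‖ ^ α)))
    (hcont.norm.pow 2).aestronglyMeasurable (Eventually.of_forall fun z => ?_)
  rw [Real.norm_of_nonneg (by positivity), hΦ.norm_sq]
  exact norm_add_apply_rpow_le hα c z.1 z.2

/-- Sums of the embedded data over subsets of a true regime concentrate at their mean. -/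
lemma eventually_integral_norm_sum_sub_sq_le (hΦ : IsPowerEmbedding α Φ)
    (hα : α ∈ Set.Ioo (0 : ℝ) 2) (h1 : A1 lam0) (h2 : A2 P α lam0 x ν) (h3 : A3 P α x u μ)
    (h5 : A5 P α lam0 x u ν μ) (c : Coef p q) (j : Fin (k + 1)) {δ : ℝ} (hδ : 0 < δ) :
    ∀ᶠ T : ℕ in atTop, ∀ A ⊆ block (trueCP lam0 T) j,
      (∀ t ∈ A, MemLp (fun ω => Φ (u T t ω + c (x T t ω)) - popMean Φ μ (ν j) c) 2 P) ∧
      ∫ ω, ‖∑ t ∈ A, (Φ (u T t ω + c (x T t ω)) - popMean Φ μ (ν j) c)‖ ^ 2 ∂P ≤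
        δ * (T : ℝ) ^ 2 := by
  have hμP := h3.isProbabilityMeasure
  have hνP := A2.isProbabilityMeasure h1 h2 j
  set M := popMean Φ μ (ν j) c with hM
  have hmem := hΦ.memLp_prod hα h3.2.2.2 (h2.2 j) c
  have hmem' : MemLp (fun z : Vec q × Vec p => Φ (z.1 + c z.2) - M) 2 (μ.prod (ν j)) :=
    hmem.sub (memLp_const M)
  set K := ∫ z : Vec q × Vec p, ‖Φ (z.1 + c z.2) - M‖ ^ 2 ∂(μ.prod (ν j)) with hK
  have hK0 : 0 ≤ K := integral_nonneg fun _ => by positivity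
  -- The limiting mean in (A5) is the mean squared distance of two independent embedded copies,
  -- hence twice the variance `K`.
  have hlim : ∫ z, ‖z.1.1 - z.1.2 + c z.2.1 - c z.2.2‖ ^ α ∂((μ.prod μ).prod ((ν j).prod (ν j)))
      = 2 * K := by
    rw [hK, hM, popMean, ← integral_norm_sub_sq_prod hmem,
      ← (measurePreserving_prod_prod_comm μ μ (ν j) (ν j)).map_eq, integral_map]
    · refine integral_congr_ae (Eventually.of_forall fun z => ?_)
      simp only
      rw [hΦ.norm_sub_sq]
      congr 2; abel
    · exact (measurePreserving_prod_prod_comm μ μ (ν j) (ν j)).measurable.aemeasurable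
    · rw [(measurePreserving_prod_prod_comm μ μ (ν j) (ν j)).map_eq]
      have hc := hΦ.continuous hα.1
      exact Continuous.aestronglyMeasurable (by fun_prop)
  obtain ⟨N, hN⟩ := h5 c c j δ hδ
  -- For `T` beyond this bound the near-diagonal contribution `2NKT` is at most `(δ/2) T²`.
  obtain ⟨T0, hT0⟩ := exists_nat_gt (4 * N * K / δ)
  filter_upwards [eventually_ge_atTop T0] with T hT A hA
  have hlaw : ∀ t ∈ A, HasLaw (fun ω => (u T t ω, x T t ω)) (μ.prod (ν j)) P :=
    fun t ht => hasLaw_prod_of_mem_block h1 h2 h3 (hA ht)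
  have hmemP : ∀ t ∈ A, MemLp (fun ω => Φ (u T t ω + c (x T t ω)) - M) 2 P := by
    intro t ht
    have h := hmem'
    rw [← (hlaw t ht).map_eq] at h
    exact (memLp_map_measure_iff h.1 (hlaw t ht).aemeasurable).1 h
  have hKP : ∀ t ∈ A, ∫ ω, ‖Φ (u T t ω + c (x T t ω)) - M‖ ^ 2 ∂P = K := by
    intro t ht
    have h := (hlaw t ht).integral_comp (f := fun z : Vec q × Vec p => ‖Φ (z.1 + c z.2) - M‖ ^ 2)
      (hmem'.1.norm.pow 2)
    exact h
  refine ⟨hmemP, ?_⟩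
  have hsq : ∀ t ∈ A, Integrable (fun ω => ‖Φ (u T t ω + c (x T t ω)) - M‖ ^ 2) P :=
    fun t ht => (memLp_two_iff_integrable_sq_norm (hmemP t ht).1).1 (hmemP t ht)
  -- Polarization: the inner product is `(‖a‖² + ‖b‖² - ‖a - b‖²)/2`, and `‖a - b‖²` is `pairDist`,
  -- of mean within `δ` of `2K`.
  have hcov : ∀ s ∈ A, ∀ t ∈ A, (N : ℤ) ≤ |(s : ℤ) - (t : ℤ)| →
      ∫ ω, inner ℝ (Φ (u T s ω + c (x T s ω)) - M) (Φ (u T t ω + c (x T t ω)) - M) ∂P ≤ δ / 2 := by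
    intro s hs t ht hst
    have hY := (hN T).2 s (hA hs) t (hA ht) hst
    rw [hlim] at hY
    have hpt : ∀ ω, inner ℝ (Φ (u T s ω + c (x T s ω)) - M) (Φ (u T t ω + c (x T t ω)) - M) =
        (‖Φ (u T s ω + c (x T s ω)) - M‖ ^ 2 + ‖Φ (u T t ω + c (x T t ω)) - M‖ ^ 2 -
          pairDist α c c (x T) (u T) s t ω) / 2 := by
      intro ω
      have h := norm_sub_sq_real (Φ (u T s ω + c (x T s ω)) - M) (Φ (u T t ω + c (x T t ω)) - M)
      rw [sub_sub_sub_cancel_right, hΦ.norm_sub_sq] at h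
      have e : u T s ω + c (x T s ω) - (u T t ω + c (x T t ω)) =
          u T s ω - u T t ω + c (x T s ω) - c (x T t ω) := by abel
      rw [e] at h
      rw [pairDist]
      linarith
    have hYi : Integrable (pairDist α c c (x T) (u T) s t) P := by
      have hb := (hmemP s hs).sub (hmemP t ht)
      have hb2 := (memLp_two_iff_integrable_sq_norm hb.1).1 hb
      refine hb2.congr (Eventually.of_forall fun ω => ?_)
      simp only [Pi.sub_apply]
      rw [sub_sub_sub_cancel_right, hΦ.norm_sub_sq, pairDist]
      congr 2; abel
    simp_rw [hpt]
    rw [integral_div, integral_sub (by exact (hsq s hs).add (hsq t ht)) hYi,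
      integral_add (hsq s hs) (hsq t ht), hKP s hs, hKP t ht]
    have := (abs_lt.1 hY).1
    linarith
  have hmain := integral_norm_sum_sq_le hmemP (by positivity : 0 ≤ δ / 2)
    (fun t ht => (hKP t ht).le) N hcov
  have hcard : (A.card : ℝ) ≤ T := by
    have h := Finset.card_le_card
      (hA.trans (block_subset_Icc (trueCP_mono h1 T) (trueCP_last h1 T) j))
    rw [Nat.card_Icc, Nat.add_sub_cancel] at h
    exact_mod_cast h
  refine hmain.trans ?_
  have hT1 : 4 * N * K / δ < T := hT0.trans_le (by exact_mod_cast hT)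
  rw [div_lt_iff₀ hδ] at hT1
  have hT0' : (0 : ℝ) ≤ T := Nat.cast_nonneg T
  calc δ / 2 * (A.card : ℝ) ^ 2 + 2 * N * K * A.card ≤ δ / 2 * (T : ℝ) ^ 2 + 2 * N * K * T := by
        gcongr
    _ ≤ δ * (T : ℝ) ^ 2 := by nlinarith

end LawOfLargeNumbers

/-! ### From convergence in probability to convergence along chosen outcomes. -/

section Selection

variable {Ω : Type*} [MeasurableSpace Ω] {P : Measure Ω}

/-- `f_T` is eventually below every positive level with probability tending to one. -/
def NegligibleInProb (P : Measure Ω) (f : ℕ → Ω → ℝ) : Prop :=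
  ∀ η : ℝ, 0 < η → Tendsto (fun T => P {ω | η ≤ f T ω}) atTop (𝓝 0)

/-- Negligible sequences converge to zero along a suitable choice of outcomes, on which
moreover a sequence bounded in probability stays bounded. -/
lemma exists_selection [IsProbabilityMeasure P] {ι : Type*} [Fintype ι] {f : ι → ℕ → Ω → ℝ}
    (hf : ∀ a, NegligibleInProb P (f a)) {R : ℕ → Ω → ℝ} {C : ℝ}
    (hR : ∀ᶠ T in atTop, P {ω | C < R T ω} ≤ 1 / 2) :
    ∃ ω : ℕ → Ω, (∀ᶠ T in atTop, R T (ω T) ≤ C) ∧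
      ∀ a, ∀ η : ℝ, 0 < η → ∀ᶠ T in atTop, f a T (ω T) < η := by
  classical
  -- Union bound: the bound on `R` fails with probability at most `1/2`, the finitely many others
  -- together with probability below `1/2`, so the bad events do not cover `Ω`.
  have hgood : ∀ n : ℕ, ∀ᶠ T in atTop, ∃ ω, R T ω ≤ C ∧ ∀ a, f a T ω < 1 / ((n : ℝ) + 1) := by
    intro n
    have hsum : Tendsto (fun T => ∑ a, P {ω | 1 / ((n : ℝ) + 1) ≤ f a T ω}) atTop (𝓝 0) := by
      have := tendsto_finsetSum Finset.univ fun a _ => hf a (1 / ((n : ℝ) + 1)) (by positivity)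
      simpa using this
    filter_upwards [hR, hsum.eventually_lt_const (by norm_num : (0 : ENNReal) < 1 / 2)]
      with T h1 h2
    by_contra! hcon
    have hcover : (Set.univ : Set Ω) ⊆
        {ω | C < R T ω} ∪ ⋃ a ∈ Finset.univ, {ω | 1 / ((n : ℝ) + 1) ≤ f a T ω} := by
      intro ω _
      by_cases h : C < R T ω
      · exact Or.inl h
      · obtain ⟨a, ha⟩ := hcon ω (not_lt.1 h)
        exact Or.inr (by simpa using ⟨a, by simpa using ha⟩)
    have h3 := (measure_mono hcover).trans ((measure_union_le _ _).trans
      (add_le_add h1 (measure_biUnion_finset_le _ _)))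
    rw [measure_univ] at h3
    have h4 : (1 / 2 : ENNReal) + ∑ a, P {ω | 1 / ((n : ℝ) + 1) ≤ f a T ω} < 1 / 2 + 1 / 2 :=
      ENNReal.add_lt_add_left (by norm_num) h2
    rw [ENNReal.add_halves] at h4
    exact absurd h3 (not_le.2 h4)
  -- Diagonal choice: `m T` is the finest level up to `T` with a good outcome, and `ω1` is a default
  -- for those `T` that have none.
  obtain ⟨T1, ω1, -⟩ := (hgood 0).exists
  set p : ℕ → ℕ → Prop := fun T n => ∃ ω, R T ω ≤ C ∧ ∀ a, f a T ω < 1 / ((n : ℝ) + 1) with hp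
  set m : ℕ → ℕ := fun T => Nat.findGreatest (p T) T with hm
  set ω : ℕ → Ω := fun T => if h : p T (m T) then h.choose else ω1 with hω
  have hspec : ∀ n : ℕ, ∀ᶠ T in atTop, n ≤ m T ∧ R T (ω T) ≤ C ∧
      ∀ a, f a T (ω T) < 1 / ((m T : ℝ) + 1) := by
    intro n
    filter_upwards [hgood n, eventually_ge_atTop n] with T h1 h2
    have h3 : p T (m T) := Nat.findGreatest_spec h2 h1
    refine ⟨Nat.le_findGreatest h2 h1, ?_⟩
    simp only [hω, dif_pos h3]
    exact h3.choose_spec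
  refine ⟨ω, (hspec 0).mono fun T h => h.2.1, fun a η hη => ?_⟩
  obtain ⟨n, hn⟩ := exists_nat_one_div_lt hη
  filter_upwards [hspec n] with T h
  refine (h.2.2 a).trans_le (le_trans ?_ hn.le)
  have : (n : ℝ) ≤ m T := by exact_mod_cast h.1
  gcongr

end Selection

/-! ### Law of large numbers, and tightness of average moments. -/

section Probability

variable {Ω : Type*} [MeasurableSpace Ω] {P : Measure Ω} [IsProbabilityMeasure P] {k p q : ℕ}
  {α : ℝ} {lam0 : Fin (k + 2) → ℝ} {x : ℕ → ℕ → Ω → Vec p} {u : ℕ → ℕ → Ω → Vec q}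
  {ν : Fin (k + 1) → Measure (Vec p)} {μ : Measure (Vec q)}
  {H : Type*} [NormedAddCommGroup H] [InnerProductSpace ℝ H] [CompleteSpace H] {Φ : Vec q → H}

/-- Law of large numbers for the embedded data over subsets of a true regime. -/
lemma negligibleInProb_norm_sum_sub (hΦ : IsPowerEmbedding α Φ)
    (hα : α ∈ Set.Ioo (0 : ℝ) 2) (h1 : A1 lam0) (h2 : A2 P α lam0 x ν) (h3 : A3 P α x u μ)
    (h5 : A5 P α lam0 x u ν μ) (c : Coef p q) (j : Fin (k + 1)) {A : ℕ → Finset ℕ}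
    (hA : ∀ T, A T ⊆ block (trueCP lam0 T) j) :
    NegligibleInProb P fun T ω =>
      (T : ℝ)⁻¹ * ‖∑ t ∈ A T, (Φ (u T t ω + c (x T t ω)) - popMean Φ μ (ν j) c)‖ := by
  intro η hη
  rw [ENNReal.tendsto_nhds_zero]
  intro e he
  rcases eq_or_ne e ⊤ with rfl | hetop
  · exact Eventually.of_forall fun _ => le_top
  have he' : 0 < e.toReal := ENNReal.toReal_pos he.ne' hetop
  -- The level `η² e` is what Markov's inequality for `‖S‖²` at height `(ηT)²` turns into
  -- probability at most `e`.
  filter_upwards [eventually_integral_norm_sum_sub_sq_le hΦ hα h1 h2 h3 h5 c j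
    (by positivity : 0 < η ^ 2 * e.toReal), eventually_gt_atTop 0] with T hT hT0
  have hT0' : (0 : ℝ) < T := by exact_mod_cast hT0
  obtain ⟨hmem, hle⟩ := hT (A T) (hA T)
  set S : Ω → H := fun ω =>
    ∑ t ∈ A T, (Φ (u T t ω + c (x T t ω)) - popMean Φ μ (ν j) c) with hS
  have hSmem : MemLp S 2 P := memLp_finsetSum _ hmem
  have hSi := (memLp_two_iff_integrable_sq_norm hSmem.1).1 hSmem
  have hmarkov := mul_meas_ge_le_integral_of_nonneg
    (Eventually.of_forall fun ω => by positivity) hSi ((η * T) ^ 2)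
  have hsub : {ω | η ≤ (T : ℝ)⁻¹ * ‖S ω‖} ⊆ {ω | (η * T) ^ 2 ≤ ‖S ω‖ ^ 2} := by
    intro ω hω
    rw [Set.mem_ofPred_eq, inv_mul_eq_div, le_div_iff₀ hT0'] at hω
    exact pow_le_pow_left₀ (by positivity) hω 2
  refine (measure_mono hsub).trans ?_
  rw [← ENNReal.ofReal_toReal hetop, ← ENNReal.ofReal_toReal (measure_ne_top P _)]
  refine ENNReal.ofReal_le_ofReal ?_
  have h6 := hmarkov.trans hle
  rw [mul_pow, show η ^ 2 * e.toReal * (T : ℝ) ^ 2 = η ^ 2 * (T : ℝ) ^ 2 * e.toReal by ring] at h6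
  rw [mul_pow]
  exact le_of_mul_le_mul_left h6 (by positivity : 0 < η ^ 2 * (T : ℝ) ^ 2)

lemma exists_mem_block_trueCP (h1 : A1 lam0) {T t : ℕ} (ht : t ∈ Finset.Icc 1 T) :
    ∃ j, t ∈ block (trueCP lam0 T) j := by
  by_contra! hcon
  have h := sum_sum_Ioc_eq (fun s => if s = t then 1 else 0) (trueCP_mono h1 T)
  rw [trueCP_zero h1, trueCP_last h1] at h
  simp only [Finset.sum_ite_eq', Finset.mem_Ioc] at h
  simp only [block, Finset.mem_Ioc] at hcon
  simp only [hcon, if_false, Finset.sum_const_zero] at h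
  rw [Finset.mem_Icc] at ht
  simp [ht.2, Nat.lt_iff_add_one_le, ht.1] at h

/-- The average `α`-th moments of the data up to time `T`. -/
def momentAvg (α : ℝ) (T : ℕ) (x : ℕ → Vec p) (u : ℕ → Vec q) : ℝ :=
  (T : ℝ)⁻¹ * ∑ t ∈ Finset.Icc 1 T, (‖u t‖ ^ α + ‖x t‖ ^ α)

/-- Markov's inequality. This bound controls the error of replacing estimated coefficients by their
limits and the contribution of short stretches of time. -/
lemma exists_measure_momentAvg_gt_le (h1 : A1 lam0)
    (h2 : A2 P α lam0 x ν) (h3 : A3 P α x u μ) :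
    ∃ C : ℝ, ∀ᶠ T in atTop,
      P {ω | C < momentAvg α T (fun t => x T t ω) (fun t => u T t ω)} ≤ 1 / 2 := by
  have hμP := h3.isProbabilityMeasure
  have hνP := A2.isProbabilityMeasure h1 h2
  set K : ℝ := ∫ z, ‖z‖ ^ α ∂μ + ∑ j, ∫ z, ‖z‖ ^ α ∂(ν j) with hK
  have hK0 : 0 ≤ K := add_nonneg (integral_nonneg fun _ => by positivity)
    (Finset.sum_nonneg fun j _ => integral_nonneg fun _ => by positivity)
  have hmeas : ∀ n : ℕ, Measurable fun z : Vec n => ‖z‖ ^ α := fun n =>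
    measurable_norm.pow_const α
  refine ⟨2 * (K + 1), ?_⟩
  filter_upwards [eventually_gt_atTop 0] with T hT0
  have hT0' : (0 : ℝ) < T := by exact_mod_cast hT0
  have hui : ∀ t ∈ Finset.Icc 1 T, Integrable (fun ω => ‖u T t ω‖ ^ α) P := by
    intro t ht
    have h := integrable_norm_rpow_of_two_mul h3.2.2.2
    rw [← (h3.1 T t ht).map_eq] at h
    exact (integrable_map_measure (hmeas q).aestronglyMeasurable (h3.1 T t ht).aemeasurable).1 h
  have hxi : ∀ t ∈ Finset.Icc 1 T, Integrable (fun ω => ‖x T t ω‖ ^ α) P ∧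
      ∫ ω, ‖x T t ω‖ ^ α ∂P ≤ ∑ j, ∫ z, ‖z‖ ^ α ∂(ν j) := by
    intro t ht
    obtain ⟨j, hj⟩ := exists_mem_block_trueCP h1 ht
    have hl := h2.1 T j t hj
    have h := integrable_norm_rpow_of_two_mul (h2.2 j)
    have h_int : ∫ ω, ‖x T t ω‖ ^ α ∂P = ∫ z, ‖z‖ ^ α ∂(ν j) :=
      hl.integral_comp (f := fun z => ‖z‖ ^ α) (hmeas p).aestronglyMeasurable
    rw [← hl.map_eq] at h
    refine ⟨(integrable_map_measure (hmeas p).aestronglyMeasurable hl.aemeasurable).1 h, ?_⟩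
    rw [h_int]
    exact Finset.single_le_sum (f := fun j => ∫ z, ‖z‖ ^ α ∂(ν j))
      (fun j _ => integral_nonneg fun _ => by positivity) (Finset.mem_univ j)
  set R : Ω → ℝ := fun ω => momentAvg α T (fun t => x T t ω) (fun t => u T t ω) with hR
  have hRi : Integrable R P :=
    (integrable_finsetSum _ fun t ht => (hui t ht).add (hxi t ht).1).const_mul _
  have hR0 : ∀ ω, 0 ≤ R ω := fun ω => by
    simp only [hR, momentAvg]; positivity
  have hRK : ∫ ω, R ω ∂P ≤ K := by
    simp only [hR, momentAvg]
    rw [integral_const_mul, inv_mul_eq_div, div_le_iff₀ hT0',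
      integral_finsetSum _ fun t ht => by exact (hui t ht).add (hxi t ht).1]
    calc _ ≤ ∑ t ∈ Finset.Icc 1 T, K := by
          refine Finset.sum_le_sum fun t ht => ?_
          rw [integral_add (hui t ht) (hxi t ht).1]
          have hu : ∫ ω, ‖u T t ω‖ ^ α ∂P = ∫ z, ‖z‖ ^ α ∂μ :=
            (h3.1 T t ht).integral_comp (f := fun z => ‖z‖ ^ α) (hmeas q).aestronglyMeasurable
          rw [hu]
          exact add_le_add le_rfl (hxi t ht).2
      _ = K * T := by rw [Finset.sum_const, Nat.card_Icc, nsmul_eq_mul]; simp [mul_comm]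
  have hmarkov := mul_meas_ge_le_integral_of_nonneg
    (Eventually.of_forall hR0) hRi (2 * (K + 1))
  have hsub : {ω | 2 * (K + 1) < R ω} ⊆ {ω | 2 * (K + 1) ≤ R ω} := fun ω hω => by
    rw [Set.mem_ofPred_eq] at hω ⊢
    exact hω.le
  refine (measure_mono hsub).trans ?_
  rw [← ENNReal.ofReal_toReal (measure_ne_top P _)]
  have h6 : P.real {ω | 2 * (K + 1) ≤ R ω} ≤ 1 / 2 := by nlinarith [hmarkov.trans hRK]
  refine (ENNReal.ofReal_le_ofReal h6).trans ?_
  rw [ENNReal.ofReal_div_of_pos (by norm_num)]; simp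

end Probability

/-! ### Lengths of intersections, and sums over few indices. -/

section Deterministic

lemma cast_card_Ioc_inter_Ioc (a b c d : ℕ) :
    ((Finset.Ioc a b ∩ Finset.Ioc c d).card : ℝ) =
      max (min (b : ℝ) d - max (a : ℝ) c) 0 := by
  rw [Finset.Ioc_inter_Ioc, Nat.card_Ioc]
  rcases le_total (a ⊔ c) (b ⊓ d) with h | h
  · rw [Nat.cast_sub h]
    have : ((a ⊔ c : ℕ) : ℝ) ≤ ((b ⊓ d : ℕ) : ℝ) := by exact_mod_cast h
    push_cast at this ⊢
    rw [max_eq_left (sub_nonneg.2 this)]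
  · rw [Nat.sub_eq_zero_of_le h]
    have : ((b ⊓ d : ℕ) : ℝ) ≤ ((a ⊔ c : ℕ) : ℝ) := by exact_mod_cast h
    push_cast at this ⊢
    rw [max_eq_right (sub_nonpos.2 this)]

/-- The length of the intersection of the intervals `(a, b]` and `(c, d]`. -/
def overlap (a b c d : ℝ) : ℝ := max (min b d - max a c) 0

lemma tendsto_card_Ioc_inter_Ioc {a b c d : ℕ → ℕ} {a' b' c' d' : ℝ}
    (ha : Tendsto (fun T => (a T : ℝ) / T) atTop (𝓝 a'))
    (hb : Tendsto (fun T => (b T : ℝ) / T) atTop (𝓝 b'))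
    (hc : Tendsto (fun T => (c T : ℝ) / T) atTop (𝓝 c'))
    (hd : Tendsto (fun T => (d T : ℝ) / T) atTop (𝓝 d')) :
    Tendsto (fun T => ((Finset.Ioc (a T) (b T) ∩ Finset.Ioc (c T) (d T)).card : ℝ) / T) atTop
      (𝓝 (overlap a' b' c' d')) := by
  refine (((hb.min hd).sub (ha.max hc)).max tendsto_const_nhds).congr fun T => ?_
  have hT : (0 : ℝ) ≤ T := Nat.cast_nonneg T
  rw [cast_card_Ioc_inter_Ioc, min_div_div_right hT, max_div_div_right hT, ← sub_div]
  conv_lhs => rw [← zero_div (T : ℝ)]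
  rw [max_div_div_right hT]

lemma tendsto_card_Ioc {a b : ℕ → ℕ} {a' b' : ℝ} (hab : a' ≤ b')
    (ha : Tendsto (fun T => (a T : ℝ) / T) atTop (𝓝 a'))
    (hb : Tendsto (fun T => (b T : ℝ) / T) atTop (𝓝 b')) :
    Tendsto (fun T => ((Finset.Ioc (a T) (b T)).card : ℝ) / T) atTop (𝓝 (b' - a')) := by
  have h := tendsto_card_Ioc_inter_Ioc ha hb ha hb
  simpa [overlap, hab] using h

lemma tendsto_card_Ioc_sdiff {a b c d : ℕ → ℕ} {a' b' : ℝ} (hab : a' ≤ b')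
    (ha : Tendsto (fun T => (a T : ℝ) / T) atTop (𝓝 a'))
    (hb : Tendsto (fun T => (b T : ℝ) / T) atTop (𝓝 b'))
    (hc : Tendsto (fun T => (c T : ℝ) / T) atTop (𝓝 a'))
    (hd : Tendsto (fun T => (d T : ℝ) / T) atTop (𝓝 b')) :
    Tendsto (fun T => ((Finset.Ioc (a T) (b T) \ Finset.Ioc (c T) (d T)).card : ℝ) / T) atTop
      (𝓝 0) := by
  have h := (tendsto_card_Ioc hab ha hb).sub (tendsto_card_Ioc_inter_Ioc ha hb hc hd)
  rw [overlap, min_self, max_self, max_eq_left (by linarith), sub_self] at h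
  refine h.congr fun T => ?_
  rw [← sub_div, ← Finset.card_sdiff_add_card_inter (Finset.Ioc (a T) (b T))
    (Finset.Ioc (c T) (d T))]
  push_cast; ring

variable {H : Type*} [NormedAddCommGroup H]

/-- By Cauchy–Schwarz the normalized sum is at most the square root of `C |S T| / T`. -/
lemma tendsto_sum_norm_of_card {S : ℕ → Finset ℕ} {f : ℕ → ℕ → H} {C : ℝ}
    (hS : Tendsto (fun T => ((S T).card : ℝ) / T) atTop (𝓝 0))
    (hf : ∀ᶠ T : ℕ in atTop, ∑ t ∈ S T, ‖f T t‖ ^ 2 ≤ C * T) :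
    Tendsto (fun T : ℕ => (T : ℝ)⁻¹ * ∑ t ∈ S T, ‖f T t‖) atTop (𝓝 0) := by
  have h0 : Tendsto (fun T => √(((S T).card : ℝ) / T * C)) atTop (𝓝 0) := by
    simpa using (hS.mul_const C).sqrt
  refine tendsto_of_tendsto_of_tendsto_of_le_of_le' tendsto_const_nhds h0
    (Eventually.of_forall fun T => by positivity) ?_
  filter_upwards [hf, eventually_gt_atTop 0] with T hT hT0
  have hT0' : (0 : ℝ) < T := by exact_mod_cast hT0
  refine Real.le_sqrt_of_sq_le ?_
  have h1 := sq_sum_le_card_mul_sum_sq (s := S T) (f := fun t => ‖f T t‖)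
  have h2 : (∑ t ∈ S T, ‖f T t‖) ^ 2 ≤ (S T).card * (C * T) :=
    h1.trans (by gcongr)
  rw [mul_pow, inv_pow, inv_mul_le_iff₀ (by positivity)]
  refine h2.trans (le_of_eq ?_)
  field_simp

lemma norm_sum_sub_sum_le (X Y : Finset ℕ) (f : ℕ → H) :
    ‖∑ t ∈ X, f t - ∑ t ∈ Y, f t‖ ≤ ∑ t ∈ X \ Y, ‖f t‖ + ∑ t ∈ Y \ X, ‖f t‖ := by
  rw [← Finset.sum_sdiff_sub_sum_sdiff]
  exact (norm_sub_le _ _).trans (add_le_add (norm_sum_le _ _) (norm_sum_le _ _))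

end Deterministic

/-! ### Limits of averaged embedded residuals and of the statistic. -/

section Deterministic

variable {H : Type*} [NormedAddCommGroup H] [InnerProductSpace ℝ H] {k p q : ℕ} {α : ℝ}
  {Φ : Vec q → H}

lemma sum_eq_mul_momentAvg {T : ℕ} (hT : 0 < T) (x : ℕ → Vec p) (u : ℕ → Vec q) :
    ∑ t ∈ Finset.Icc 1 T, (‖u t‖ ^ α + ‖x t‖ ^ α) = T * momentAvg α T x u := by
  have : (T : ℝ) ≠ 0 := by exact_mod_cast hT.ne'
  rw [momentAvg, mul_inv_cancel_left₀ this]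

lemma sum_norm_add_apply_rpow_le (hα : α ∈ Set.Ioo (0 : ℝ) 2) {T : ℕ} (hT : 0 < T)
    {S : Finset ℕ} (hS : S ⊆ Finset.Icc 1 T) (x : ℕ → Vec p) (u : ℕ → Vec q) (c : Coef p q) :
    ∑ t ∈ S, ‖u t + c (x t)‖ ^ α ≤ 4 * (1 + ‖c‖ ^ α) * momentAvg α T x u * T := by
  calc _ ≤ ∑ t ∈ S, 4 * (1 + ‖c‖ ^ α) * (‖u t‖ ^ α + ‖x t‖ ^ α) :=
        Finset.sum_le_sum fun t _ => norm_add_apply_rpow_le hα c (u t) (x t)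
    _ ≤ ∑ t ∈ Finset.Icc 1 T, 4 * (1 + ‖c‖ ^ α) * (‖u t‖ ^ α + ‖x t‖ ^ α) :=
        Finset.sum_le_sum_of_subset_of_nonneg hS fun _ _ _ => by positivity
    _ = _ := by rw [← Finset.mul_sum, sum_eq_mul_momentAvg hT]; ring

lemma rpow_half_le_one_add {a : ℝ} (ha : 0 ≤ a) : a ^ (α / 2) ≤ 1 + a ^ α := by
  have : a ^ α = (a ^ (α / 2)) ^ 2 := by
    rw [← Real.rpow_natCast, ← Real.rpow_mul ha]; congr 1; push_cast; ring
  rw [this]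
  nlinarith [sq_nonneg (a ^ (α / 2) - 1)]

/-- `Φ` is Hölder continuous of order `α/2`, so a change of coefficient costs `‖c - d‖^(α/2)` times
an average moment. -/
lemma IsPowerEmbedding.sum_norm_sub_le (hΦ : IsPowerEmbedding α Φ) (hα : α ∈ Set.Ioo (0 : ℝ) 2)
    {T : ℕ} (hT : 0 < T) {S : Finset ℕ} (hS : S ⊆ Finset.Icc 1 T) (x : ℕ → Vec p)
    (u : ℕ → Vec q) (c d : Coef p q) :
    ∑ t ∈ S, ‖Φ (u t + c (x t)) - Φ (u t + d (x t))‖ ≤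
      ‖c - d‖ ^ (α / 2) * (1 + momentAvg α T x u) * T := by
  have h : ∀ t, ‖Φ (u t + c (x t)) - Φ (u t + d (x t))‖ ≤
      ‖c - d‖ ^ (α / 2) * (1 + (‖u t‖ ^ α + ‖x t‖ ^ α)) := by
    intro t
    rw [hΦ.norm_sub, add_sub_add_left_eq_sub, ← sub_apply]
    calc _ ≤ (‖c - d‖ * ‖x t‖) ^ (α / 2) :=
          Real.rpow_le_rpow (norm_nonneg _) ((c - d).le_opNorm _) (by linarith [hα.1])
      _ = ‖c - d‖ ^ (α / 2) * ‖x t‖ ^ (α / 2) := Real.mul_rpow (norm_nonneg _) (norm_nonneg _)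
      _ ≤ _ := by
          gcongr
          have := rpow_half_le_one_add (α := α) (norm_nonneg (x t))
          have : 0 ≤ ‖u t‖ ^ α := by positivity
          linarith
  calc _ ≤ ∑ t ∈ S, ‖c - d‖ ^ (α / 2) * (1 + (‖u t‖ ^ α + ‖x t‖ ^ α)) :=
        Finset.sum_le_sum fun t _ => h t
    _ ≤ ∑ t ∈ Finset.Icc 1 T, ‖c - d‖ ^ (α / 2) * (1 + (‖u t‖ ^ α + ‖x t‖ ^ α)) :=
        Finset.sum_le_sum_of_subset_of_nonneg hS fun _ _ _ => by positivity
    _ = _ := by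
        rw [← Finset.mul_sum, Finset.sum_add_distrib, sum_eq_mul_momentAvg hT]
        simp; ring

/-- Sums of embedded residuals over the part of an estimated regime inside a true regime. -/
lemma IsPowerEmbedding.tendsto_sum_inter (hΦ : IsPowerEmbedding α Φ)
    (hα : α ∈ Set.Ioo (0 : ℝ) 2) {lam0 : Fin (k + 2) → ℝ} (h1 : A1 lam0) (l : Fin (k + 1))
    {x : ℕ → ℕ → Vec p} {u : ℕ → ℕ → Vec q} {C : ℝ}
    (hC : ∀ᶠ T in atTop, momentAvg α T (x T) (u T) ≤ C) {c : Coef p q} {d : ℕ → Coef p q}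
    (hd : Tendsto d atTop (𝓝 c)) {a b : ℕ → ℕ} {a' b' : ℝ} (ha' : 0 ≤ a') (hab : a' ≤ b')
    (ha : Tendsto (fun T => (a T : ℝ) / T) atTop (𝓝 a'))
    (hb : Tendsto (fun T => (b T : ℝ) / T) atTop (𝓝 b')) {M : H}
    (hM : Tendsto (fun T : ℕ => (T : ℝ)⁻¹ *
      ‖∑ t ∈ Finset.Ioc ⌊(T : ℝ) * a'⌋₊ ⌊(T : ℝ) * b'⌋₊ ∩ block (trueCP lam0 T) l,
        (Φ (u T t + c (x T t)) - M)‖) atTop (𝓝 0)) :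
    Tendsto (fun T : ℕ => (T : ℝ)⁻¹ •
      ∑ t ∈ Finset.Ioc (a T) (b T) ∩ block (trueCP lam0 T) l, Φ (u T t + d T (x T t))) atTop
      (𝓝 (overlap a' b' (lam0 l.castSucc) (lam0 l.succ) • M)) := by
  set B : ℕ → Finset ℕ := fun T => Finset.Ioc (a T) (b T) with hB
  set D : ℕ → Finset ℕ := fun T => Finset.Ioc ⌊(T : ℝ) * a'⌋₊ ⌊(T : ℝ) * b'⌋₊ with hD
  set R : ℕ → Finset ℕ := fun T => block (trueCP lam0 T) l with hR
  have hRsub : ∀ T, R T ⊆ Finset.Icc 1 T := fun T =>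
    block_subset_Icc (trueCP_mono h1 T) (trueCP_last h1 T) l
  have hDa := tendsto_floor_mul_div a' ha'
  have hDb := tendsto_floor_mul_div b' (ha'.trans hab)
  -- The law of large numbers `hM` concerns a fixed coefficient and the interval with the limiting
  -- end points. So `d T` is replaced by `c` (`t1`), `B T` by `D T` (`t2`) and the data by their
  -- mean (`t3`), each with error `o(T)`; `t4` counts the remaining indices.
  have t1 : Tendsto (fun T : ℕ => (T : ℝ)⁻¹ • ∑ t ∈ B T ∩ R T,
      (Φ (u T t + d T (x T t)) - Φ (u T t + c (x T t)))) atTop (𝓝 0) := by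
    have hd0 : Tendsto (fun T => ‖d T - c‖ ^ (α / 2) * (1 + C)) atTop (𝓝 0) := by
      have := ((tendsto_iff_norm_sub_tendsto_zero.1 hd).rpow_const
        (Or.inr (by linarith [hα.1]) : (0 : ℝ) ≠ 0 ∨ 0 ≤ α / 2)).mul_const (1 + C)
      rwa [Real.zero_rpow (by linarith [hα.1]), zero_mul] at this
    refine squeeze_zero_norm' ?_ hd0
    filter_upwards [hC, eventually_gt_atTop 0] with T hT hT0
    have hT0' : (0 : ℝ) < T := by exact_mod_cast hT0
    rw [norm_smul, norm_inv, Real.norm_of_nonneg hT0'.le, inv_mul_le_iff₀ hT0']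
    refine (norm_sum_le _ _).trans ((hΦ.sum_norm_sub_le hα hT0
      (Finset.inter_subset_right.trans (hRsub T)) (x T) (u T) (d T) c).trans ?_)
    rw [mul_comm (T : ℝ)]
    gcongr
  have hsmall : ∀ S : ℕ → Finset ℕ, (∀ T, S T ⊆ R T) →
      Tendsto (fun T => ((S T).card : ℝ) / T) atTop (𝓝 0) →
      Tendsto (fun T : ℕ => (T : ℝ)⁻¹ * ∑ t ∈ S T, ‖Φ (u T t + c (x T t))‖) atTop (𝓝 0) := by
    intro S hS hS0
    refine tendsto_sum_norm_of_card (f := fun T t => Φ (u T t + c (x T t)))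
      (C := 4 * (1 + ‖c‖ ^ α) * C) hS0 ?_
    filter_upwards [hC, eventually_gt_atTop 0] with T hT hT0
    simp_rw [hΦ.norm_sq]
    refine (sum_norm_add_apply_rpow_le hα hT0 ((hS T).trans (hRsub T)) (x T) (u T) c).trans ?_
    gcongr
  have hsub : ∀ X Y Z : Finset ℕ, (X ∩ Z) \ (Y ∩ Z) ⊆ X \ Y := by
    intro X Y Z t ht
    simp only [Finset.mem_sdiff, Finset.mem_inter, not_and] at ht ⊢
    exact ⟨ht.1.1, fun h => ht.2 h ht.1.2⟩
  have hcard : ∀ X Y : ℕ → Finset ℕ,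
      Tendsto (fun T => ((X T \ Y T).card : ℝ) / T) atTop (𝓝 0) →
      Tendsto (fun T => (((X T ∩ R T) \ (Y T ∩ R T)).card : ℝ) / T) atTop (𝓝 0) := by
    intro X Y h
    refine tendsto_of_tendsto_of_tendsto_of_le_of_le tendsto_const_nhds h
      (fun T => by positivity) fun T => ?_
    exact div_le_div_of_nonneg_right (Nat.cast_le.2 (Finset.card_le_card (hsub (X T) (Y T) (R T))))
      (Nat.cast_nonneg T)
  have t2 : Tendsto (fun T : ℕ => (T : ℝ)⁻¹ • (∑ t ∈ B T ∩ R T, Φ (u T t + c (x T t)) -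
      ∑ t ∈ D T ∩ R T, Φ (u T t + c (x T t)))) atTop (𝓝 0) := by
    have s1 := hsmall (fun T => (B T ∩ R T) \ (D T ∩ R T))
      (fun T => Finset.sdiff_subset.trans Finset.inter_subset_right)
      (hcard B D (tendsto_card_Ioc_sdiff hab ha hb hDa hDb))
    have s2 := hsmall (fun T => (D T ∩ R T) \ (B T ∩ R T))
      (fun T => Finset.sdiff_subset.trans Finset.inter_subset_right)
      (hcard D B (tendsto_card_Ioc_sdiff hab hDa hDb ha hb))
    have s3 := s1.add s2
    rw [add_zero] at s3
    refine squeeze_zero_norm (fun T => ?_) s3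
    rw [norm_smul, norm_inv, Real.norm_of_nonneg (Nat.cast_nonneg T), ← mul_add]
    gcongr
    exact norm_sum_sub_sum_le _ _ _
  have t3 : Tendsto (fun T : ℕ => (T : ℝ)⁻¹ • ∑ t ∈ D T ∩ R T, (Φ (u T t + c (x T t)) - M))
      atTop (𝓝 0) := by
    refine squeeze_zero_norm (fun T => ?_) hM
    rw [norm_smul, norm_inv, Real.norm_of_nonneg (Nat.cast_nonneg T)]
  have t4 : Tendsto (fun T : ℕ => (((D T ∩ R T).card : ℝ) / T) • M) atTop
      (𝓝 (overlap a' b' (lam0 l.castSucc) (lam0 l.succ) • M)) :=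
    (tendsto_card_Ioc_inter_Ioc hDa hDb (tendsto_trueCP_div h1 _)
      (tendsto_trueCP_div h1 _)).smul_const M
  have hsum := ((t1.add t2).add t3).add t4
  simp only [zero_add] at hsum
  refine hsum.congr fun T => ?_
  simp only [Finset.sum_sub_distrib, Finset.sum_const]
  rw [div_eq_inv_mul, mul_smul, Nat.cast_smul_eq_nsmul, ← smul_add, ← smul_add, ← smul_add]
  congr 1
  abel

/-- Averages of the embedded residuals over a regime converge to the mean embedding of a mixture
over the true regimes. -/
lemma IsPowerEmbedding.tendsto_avg_block (hΦ : IsPowerEmbedding α Φ)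
    (hα : α ∈ Set.Ioo (0 : ℝ) 2) {lam0 : Fin (k + 2) → ℝ} (h1 : A1 lam0)
    {x : ℕ → ℕ → Vec p} {u y : ℕ → ℕ → Vec q} {β0 : Fin (k + 1) → Coef p q}
    (hmodel : ∀ T, ∀ l, ∀ t ∈ block (trueCP lam0 T) l, y T t = β0 l (x T t) + u T t) {C : ℝ}
    (hC : ∀ᶠ T in atTop, momentAvg α T (x T) (u T) ≤ C) {bc : Coef p q} {b : ℕ → Coef p q}
    (hb : Tendsto b atTop (𝓝 bc)) {τ : ℕ → Fin (k + 2) → ℕ}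
    (hτ : ∀ᶠ T in atTop, Monotone (τ T) ∧ τ T (Fin.last (k + 1)) = T) {lam : Fin (k + 2) → ℝ}
    (hlam : StrictMono lam) (hlam0 : 0 ≤ lam 0)
    (hfrac : ∀ j, Tendsto (fun T => (τ T j : ℝ) / T) atTop (𝓝 (lam j))) {i : Fin (k + 1)}
    {M : Fin (k + 1) → H}
    (hM : ∀ l, Tendsto (fun T : ℕ => (T : ℝ)⁻¹ *
      ‖∑ t ∈ Finset.Ioc ⌊(T : ℝ) * lam i.castSucc⌋₊ ⌊(T : ℝ) * lam i.succ⌋₊ ∩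
        block (trueCP lam0 T) l, (Φ (u T t + (β0 l - bc) (x T t)) - M l)‖) atTop (𝓝 0)) :
    Tendsto (fun T => avg (block (τ T) i) fun t => Φ (y T t - b T (x T t))) atTop
      (𝓝 ((lam i.succ - lam i.castSucc)⁻¹ • ∑ l,
        overlap (lam i.castSucc) (lam i.succ) (lam0 l.castSucc) (lam0 l.succ) • M l)) := by
  have hlt : lam i.castSucc < lam i.succ := hlam Fin.castSucc_lt_succ
  have h0 : 0 ≤ lam i.castSucc := hlam0.trans (hlam.monotone (Fin.zero_le _))
  have hreg : ∀ l, Tendsto (fun T : ℕ => (T : ℝ)⁻¹ • ∑ t ∈ block (τ T) i ∩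
      block (trueCP lam0 T) l, Φ (u T t + (β0 l - b T) (x T t))) atTop
      (𝓝 (overlap (lam i.castSucc) (lam i.succ) (lam0 l.castSucc) (lam0 l.succ) • M l)) :=
    fun l => hΦ.tendsto_sum_inter hα h1 l hC (d := fun T => β0 l - b T)
      (tendsto_const_nhds.sub hb) h0 hlt.le (hfrac _) (hfrac _) (hM l)
  have hcard : Tendsto (fun T => ((block (τ T) i).card : ℝ) / T) atTop
      (𝓝 (lam i.succ - lam i.castSucc)) := tendsto_card_Ioc hlt.le (hfrac _) (hfrac _)
  have hlim := (hcard.inv₀ (sub_pos.2 hlt).ne').smul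
    (tendsto_finsetSum Finset.univ fun l _ => hreg l)
  refine hlim.congr' ?_
  filter_upwards [hτ, eventually_gt_atTop 0] with T hT hT0
  have hT0' : (T : ℝ) ≠ 0 := by exact_mod_cast hT0.ne'
  rw [← Finset.smul_sum, smul_smul, avg]
  congr 1
  · field_simp
  -- The regime is cut along the true partition, since the model equation differs from one true
  -- regime to the next.
  · have hs := sum_sum_Ioc_eq
      (fun t => if t ∈ block (τ T) i then Φ (y T t - b T (x T t)) else 0) (trueCP_mono h1 T)
    rw [trueCP_zero h1, trueCP_last h1] at hs
    simp only [Finset.sum_ite_mem] at hs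
    have hsubset : Finset.Ioc 0 T ∩ block (τ T) i = block (τ T) i :=
      Finset.inter_eq_right.2 (block_subset_Icc hT.1 hT.2 i)
    rw [hsubset] at hs
    rw [← hs]
    refine Finset.sum_congr rfl fun l _ => ?_
    rw [Finset.inter_comm]
    refine Finset.sum_congr rfl fun t ht => ?_
    rw [hmodel T l t (Finset.mem_inter.1 ht).1]
    congr 1
    simp only [sub_apply]
    abel

/-- The limit of the rescaled goodness-of-fit statistic. -/
lemma IsPowerEmbedding.tendsto_multiEnergy_div (hΦ : IsPowerEmbedding α Φ) (hα : 0 < α)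
    {x : ℕ → ℕ → Vec p} {y : ℕ → ℕ → Vec q} {b : ℕ → Fin (k + 1) → Coef p q}
    {τ : ℕ → Fin (k + 2) → ℕ} {w : Fin (k + 1) → ℝ} (hw : ∀ i, 0 < w i)
    (hcard : ∀ i, Tendsto (fun T => ((block (τ T) i).card : ℝ) / T) atTop (𝓝 (w i)))
    {m : Fin (k + 1) → H}
    (hm : ∀ i, Tendsto (fun T => avg (block (τ T) i) fun t => Φ (y T t - b T i (x T t))) atTop
      (𝓝 (m i))) {C : Fin (k + 1) → ℝ}
    (hC : ∀ i, ∀ᶠ T : ℕ in atTop, ∑ t ∈ block (τ T) i, ‖y T t - b T i (x T t)‖ ^ α ≤ C i * T) :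
    Tendsto (fun T => multiEnergy α T (x T) (y T) (τ T) (b T) / T) atTop
      (𝓝 (∑ i, ∑ j ∈ Finset.Ioi i, w i * w j * ‖m i - m j‖ ^ 2)) := by
  have hcardtop : ∀ i, Tendsto (fun T => ((block (τ T) i).card : ℝ)) atTop atTop := by
    intro i
    refine ((hcard i).pos_mul_atTop (hw i) tendsto_natCast_atTop_atTop).congr' ?_
    filter_upwards [eventually_gt_atTop 0] with T hT0
    have hT0' : (T : ℝ) ≠ 0 := by exact_mod_cast hT0.ne'
    field_simp
  have hcard2 : ∀ i, ∀ᶠ T in atTop, 2 ≤ (block (τ T) i).card := fun i =>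
    ((hcardtop i).eventually_ge_atTop 2).mono fun T hT => by exact_mod_cast hT
  set V : Fin (k + 1) → ℕ → ℝ := fun i T => meanBetween α (block (τ T) i) (block (τ T) i)
    (fun t => y T t - b T i (x T t)) (fun t => y T t - b T i (x T t)) with hV
  -- The diagonal correction vanishes: the mean `V i T` stays bounded while the number of points
  -- tends to infinity.
  have hVlim : ∀ i, Tendsto (fun T => V i T / ((block (τ T) i).card - 1)) atTop (𝓝 0) := by
    intro i
    have h1 : Tendsto (fun T : ℕ => 2 * (((block (τ T) i).card / (T : ℝ))⁻¹ * C i) *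
        ((block (τ T) i).card - 1 : ℝ)⁻¹) atTop (𝓝 0) := by
      have := ((((hcard i).inv₀ (hw i).ne').mul_const (C i)).const_mul 2).mul
        ((tendsto_atTop_add_const_right _ (-1) (hcardtop i)).inv_tendsto_atTop)
      rw [mul_zero] at this
      exact this
    refine tendsto_of_tendsto_of_tendsto_of_le_of_le' tendsto_const_nhds h1 ?_ ?_
    · filter_upwards [hcard2 i] with T hT
      have hn : (2 : ℝ) ≤ (block (τ T) i).card := by exact_mod_cast hT
      exact div_nonneg (meanBetween_nonneg _ _ _ _ _) (by linarith)
    · filter_upwards [hcard2 i, hC i, eventually_gt_atTop 0] with T hT hCT hT0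
      have hn : (2 : ℝ) ≤ (block (τ T) i).card := by exact_mod_cast hT
      have hT0' : (0 : ℝ) < T := by exact_mod_cast hT0
      rw [div_eq_mul_inv]
      refine mul_le_mul_of_nonneg_right ?_ (inv_nonneg.2 (by linarith))
      refine (hΦ.meanBetween_self_le (Finset.card_pos.1 (by omega)) _).trans ?_
      rw [inv_div, div_eq_inv_mul, mul_assoc, mul_comm (T : ℝ)]
      gcongr
  -- The factor `n_i + n_j` cancels between the weight and the energy distance, as do the two
  -- factors `2`, leaving `(n_i/T)(n_j/T)`.
  have hpair : ∀ i j, Tendsto (fun T => (((block (τ T) i).card : ℝ) + ((block (τ T) j).card : ℝ)) /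
      (2 * (T : ℝ)) * energyDist α (block (τ T) i) (block (τ T) j)
        (fun t => y T t - b T i (x T t)) (fun t => y T t - b T j (x T t)) / T) atTop
      (𝓝 (w i * w j * ‖m i - m j‖ ^ 2)) := by
    intro i j
    have h1 := ((hcard i).mul (hcard j)).mul
      ((((hm i).sub (hm j)).norm.pow 2).sub (((hVlim i).add (hVlim j)).div_const 2))
    rw [add_zero, zero_div, sub_zero] at h1
    refine h1.congr' ?_
    filter_upwards [hcard2 i, hcard2 j, eventually_gt_atTop 0] with T hi hj hT0
    have hT0' : (0 : ℝ) < T := by exact_mod_cast hT0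
    have hni : (2 : ℝ) ≤ (block (τ T) i).card := by exact_mod_cast hi
    have hnj : (2 : ℝ) ≤ (block (τ T) j).card := by exact_mod_cast hj
    have hE := hΦ.two_mul_meanBetween_sub (A := block (τ T) i) (B := block (τ T) j)
      (Finset.card_pos.1 (by omega)) (Finset.card_pos.1 (by omega))
      (fun t => y T t - b T i (x T t)) (fun t => y T t - b T j (x T t))
    rw [energyDist, meanWithin_eq hα hi, meanWithin_eq hα hj]
    simp only [hV]
    generalize meanBetween α (block (τ T) i) (block (τ T) i) _ _ = Vi at hE ⊢
    generalize meanBetween α (block (τ T) j) (block (τ T) j) _ _ = Vj at hE ⊢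
    generalize meanBetween α (block (τ T) i) (block (τ T) j) _ _ = Vij at hE ⊢
    generalize Vi / ((block (τ T) i).card - 1 : ℝ) = ei
    generalize Vj / ((block (τ T) j).card - 1 : ℝ) = ej
    generalize ‖(_ - _ : H)‖ ^ 2 = D at hE ⊢
    have hD : 2 * Vij - (Vi + ei) - (Vj + ej) = 2 * (D - (ei + ej) / 2) := by linarith
    rw [hD]
    have hne : ((block (τ T) i).card : ℝ) + (block (τ T) j).card ≠ 0 := by linarith
    field_simp
  have hsum := tendsto_finsetSum Finset.univ fun i (_ : i ∈ Finset.univ) =>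
    tendsto_finsetSum (Finset.Ioi i) fun j _ => hpair i j
  refine hsum.congr fun T => ?_
  simp_rw [multiEnergy, Finset.sum_div]

end Deterministic

/-! ### Mixtures with the mean embedding of the disturbances. -/

section Mixture

lemma conv_finsetSum_smul {E ι : Type*} [AddCommMonoid E] [MeasurableSpace E] [MeasurableAdd₂ E]
    (μ : Measure E) [IsFiniteMeasure μ] (s : Finset ι) (w : ι → ℝ) (g : ι → Measure E)
    [∀ i, IsFiniteMeasure (g i)] :
    μ ∗ (∑ i ∈ s, ENNReal.ofReal (w i) • g i) = ∑ i ∈ s, ENNReal.ofReal (w i) • (μ ∗ g i) := by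
  classical
  have hfin : ∀ i, IsFiniteMeasure (ENNReal.ofReal (w i) • g i) := fun i =>
    Measure.smul_finite _ ENNReal.ofReal_ne_top
  induction s using Finset.induction_on with
  | empty => simp
  | insert i s hi ih =>
    rw [Finset.sum_insert hi, Finset.sum_insert hi, Measure.conv_add, ih, Measure.conv_comm,
      Measure.conv_smul_left, Measure.conv_comm]

variable {p q k : ℕ} {H : Type*} [NormedAddCommGroup H] [InnerProductSpace ℝ H] [CompleteSpace H]
  {α : ℝ} {Φ : Vec q → H}

lemma popMean_zero (μ : Measure (Vec q)) (ν : Measure (Vec p)) [IsProbabilityMeasure μ]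
    [IsProbabilityMeasure ν] : popMean Φ μ ν 0 = ∫ v, Φ v ∂μ := by
  simp only [popMean, zero_apply, add_zero]
  rw [integral_fun_fst Φ]; simp

lemma map_add_apply_eq_conv (μ : Measure (Vec q)) (ν : Measure (Vec p)) [IsProbabilityMeasure μ]
    [IsProbabilityMeasure ν] (c : Coef p q) :
    (μ.prod ν).map (fun z => z.1 + c z.2) = μ ∗ ν.map c := by
  have hc : Measurable c := c.continuous.measurable
  have : IsProbabilityMeasure (ν.map c) := Measure.isProbabilityMeasure_map hc.aemeasurable
  rw [Measure.conv]
  conv_rhs => rw [← Measure.map_id (μ := μ)]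
  rw [Measure.map_prod_map _ _ measurable_id hc, Measure.map_map (by fun_prop) (by fun_prop)]
  rfl

/-- If a mixture of the laws of `U + c_l X_l` has the mean embedding of the law of `U`, then
`c_l X_l = 0` almost surely for all `l` of positive weight. -/
lemma ae_apply_eq_zero_of_sum_popMean_eq (hΦ : IsPowerEmbedding α Φ)
    (hα : α ∈ Set.Ioo (0 : ℝ) 2)
    (hinj : ∀ F G : Measure (Vec q), IsProbabilityMeasure F → IsProbabilityMeasure G →
        Integrable Φ F → Integrable Φ G → ∫ v, Φ v ∂F = ∫ v, Φ v ∂G → F = G)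
    {μ : Measure (Vec q)} {ν : Fin (k + 1) → Measure (Vec p)} [IsProbabilityMeasure μ]
    [∀ l, IsProbabilityMeasure (ν l)] (hμ : Integrable (fun z => ‖z‖ ^ (2 * α)) μ)
    (hν : ∀ l, Integrable (fun z => ‖z‖ ^ (2 * α)) (ν l)) {w : Fin (k + 1) → ℝ}
    (hw : ∀ l, 0 ≤ w l) (hw1 : ∑ l, w l = 1) {c : Fin (k + 1) → Coef p q}
    (h : ∑ l, w l • popMean Φ μ (ν l) (c l) = ∫ v, Φ v ∂μ) {l : Fin (k + 1)} (hl : 0 < w l) :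
    ∀ᵐ z ∂(ν l), c l z = 0 := by
  have hc : ∀ l, Measurable (c l) := fun l => (c l).continuous.measurable
  have hgP : ∀ l, IsProbabilityMeasure ((ν l).map (c l)) := fun l =>
    Measure.isProbabilityMeasure_map (hc l).aemeasurable
  set G : Measure (Vec q) := ∑ l, ENNReal.ofReal (w l) • (ν l).map (c l) with hG
  have hmap : ∀ c : Coef p q, Measurable fun z : Vec q × Vec p => z.1 + c z.2 := fun c =>
    (by fun_prop : Continuous fun z : Vec q × Vec p => z.1 + c z.2).measurable
  have hΦm : ∀ F : Measure (Vec q), AEStronglyMeasurable Φ F := fun F =>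
    (hΦ.continuous hα.1).aestronglyMeasurable
  have hΦl : ∀ l, Integrable Φ (μ ∗ (ν l).map (c l)) ∧
      ∫ v, Φ v ∂(μ ∗ (ν l).map (c l)) = popMean Φ μ (ν l) (c l) := by
    intro l
    rw [← map_add_apply_eq_conv]
    refine ⟨(integrable_map_measure (hΦm _) (hmap _).aemeasurable).2
      ((hΦ.memLp_prod hα hμ (hν l) (c l)).integrable one_le_two), ?_⟩
    rw [integral_map (hmap _).aemeasurable (hΦm _)]
    rfl
  have hsum : ∑ l, ENNReal.ofReal (w l) = 1 := by
    rw [← ENNReal.ofReal_sum_of_nonneg fun l _ => hw l, hw1, ENNReal.ofReal_one]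
  have hGP : IsProbabilityMeasure G := by
    refine ⟨?_⟩
    rw [hG, Measure.finsetSum_apply]
    simpa using hsum
  have hconv : μ ∗ G = ∑ l, ENNReal.ofReal (w l) • (μ ∗ (ν l).map (c l)) :=
    conv_finsetSum_smul μ _ w _
  have h_int : ∀ l ∈ Finset.univ, Integrable Φ (ENNReal.ofReal (w l) • (μ ∗ (ν l).map (c l))) :=
    fun l _ => (hΦl l).1.smul_measure ENNReal.ofReal_ne_top
  have hμΦ : Integrable Φ μ := by
    have h0 := (hΦ.memLp_prod hα hμ (hν 0) 0).integrable one_le_two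
    simp only [zero_apply, add_zero] at h0
    exact (measurePreserving_fst.integrable_comp (hΦm μ)).1 h0
  -- The mixture of the laws of `U + c_l X_l` is `μ ∗ G`, so injectivity of the mean embedding
  -- applies.
  have hself : μ ∗ G = μ := by
    refine hinj _ _ inferInstance inferInstance ?_ hμΦ ?_
    · rw [hconv]; exact integrable_finsetSum_measure.2 h_int
    · rw [hconv, integral_finsetSum_measure h_int, ← h]
      refine Finset.sum_congr rfl fun l _ => ?_
      rw [integral_smul_measure, (hΦl l).2, ENNReal.toReal_ofReal (hw l)]
  have hzero := ae_eq_zero_of_conv_eq_self hself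
  -- A null set of the mixture is null for every component of positive weight.
  rw [ae_iff, hG, Measure.finsetSum_apply, Finset.sum_eq_zero_iff] at hzero
  have h0 := hzero l (Finset.mem_univ l)
  rw [Measure.smul_apply, smul_eq_mul, mul_eq_zero, ENNReal.ofReal_eq_zero] at h0
  have h1 : ∀ᵐ z ∂((ν l).map (c l)), z = 0 := h0.resolve_left (not_le.2 hl)
  exact ae_of_ae_map (hc l).aemeasurable h1

end Mixture

/-! ### Overlaps of intervals. -/

section Overlap

lemma overlap_nonneg (a b c d : ℝ) : 0 ≤ overlap a b c d := le_max_right _ _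

/-- As increments of `t ↦ max a (min b t)`, the overlaps with consecutive intervals telescope. -/
lemma overlap_eq_clamp_sub {a b c d : ℝ} (hab : a ≤ b) (hcd : c ≤ d) :
    overlap a b c d = max a (min b d) - max a (min b c) := by
  unfold overlap
  rcases le_total b d with h1 | h1 <;> rcases le_total a c with h2 | h2 <;>
    rcases le_total b c with h3 | h3 <;> rcases le_total a d with h4 | h4 <;>
    simp only [min_eq_left, min_eq_right, max_eq_left, max_eq_right, *] <;>
    first
    | (rw [max_eq_left (by linarith)]; done)
    | (rw [max_eq_right (by linarith)]; linarith)

lemma sum_fin_sub {n : ℕ} (f : Fin (n + 1) → ℝ) :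
    ∑ i : Fin n, (f i.succ - f i.castSucc) = f (Fin.last n) - f 0 := by
  induction n with
  | zero => simp
  | succ n ih =>
    rw [Fin.sum_univ_castSucc]
    have := ih fun i => f i.castSucc
    simp only [Fin.succ_castSucc, Fin.succ_last] at this ⊢
    rw [this]
    simp

lemma sum_overlap {k : ℕ} {lam0 : Fin (k + 2) → ℝ} (h1 : A1 lam0) {a b : ℝ} (ha : 0 ≤ a)
    (hab : a ≤ b) (hb : b ≤ 1) :
    ∑ l : Fin (k + 1), overlap a b (lam0 l.castSucc) (lam0 l.succ) = b - a := by
  have h : ∀ l : Fin (k + 1), overlap a b (lam0 l.castSucc) (lam0 l.succ) =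
      max a (min b (lam0 l.succ)) - max a (min b (lam0 l.castSucc)) := fun l =>
    overlap_eq_clamp_sub hab (h1.1 Fin.castSucc_lt_succ).le
  simp_rw [h]
  rw [sum_fin_sub fun i => max a (min b (lam0 i)), h1.2.1, h1.2.2, min_eq_left hb, max_eq_right hab,
    min_eq_right (ha.trans hab), max_eq_left ha]

lemma overlap_regime {k : ℕ} {lam0 : Fin (k + 2) → ℝ} (h1 : A1 lam0) {a b : ℝ} (hab : a ≤ b)
    {i : Fin (k + 1)} (ha : lam0 i.castSucc ≤ a) (hb : b ≤ lam0 i.succ) (l : Fin (k + 1)) :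
    overlap a b (lam0 l.castSucc) (lam0 l.succ) = if l = i then b - a else 0 := by
  rcases lt_trichotomy l i with h | h | h
  · rw [if_neg h.ne, overlap, max_eq_right]
    have h2 : lam0 l.succ ≤ lam0 i.castSucc := h1.1.monotone (Fin.succ_le_castSucc_iff.2 h)
    linarith [min_le_right b (lam0 l.succ), le_max_left a (lam0 l.castSucc)]
  · subst h
    rw [if_pos rfl, overlap, min_eq_left hb, max_eq_left ha, max_eq_left (by linarith)]
  · rw [if_neg h.ne', overlap, max_eq_right]
    have h2 : lam0 i.succ ≤ lam0 l.castSucc := h1.1.monotone (Fin.succ_le_castSucc_iff.2 h)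
    linarith [min_le_left b (lam0 l.succ), le_max_right a (lam0 l.castSucc)]

/-- A change point `y` inside `(a, b)` makes this interval meet the regimes on both sides of `y`. -/
lemma overlap_pos {a b c d y : ℝ} (h : (a < y ∧ y < b) ∧ ((c < y ∧ d = y) ∨ (c = y ∧ y < d))) :
    0 < overlap a b c d := by
  refine lt_max_of_lt_left (sub_pos.2 (max_lt_iff.2 ?_))
  simp only [lt_min_iff]
  rcases h with ⟨⟨h1, h2⟩, ⟨h3, h4⟩ | ⟨h3, h4⟩⟩
  · exact ⟨⟨by linarith, by linarith⟩, by linarith, by linarith⟩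
  · exact ⟨⟨by linarith, by linarith⟩, by linarith, by linarith⟩

end Overlap

/-! ### Comparing two partitions with equally many regimes. -/

section Combinatorics

/-- Of two partitions of the same interval, the first has a regime contained in the regime of
the second with the same index. -/
lemma exists_regime_le {n : ℕ} {τ σ : Fin (n + 2) → ℕ} (h0 : σ 0 ≤ τ 0)
    (hlast : τ (Fin.last (n + 1)) ≤ σ (Fin.last (n + 1))) :
    ∃ i : Fin (n + 1), σ i.castSucc ≤ τ i.castSucc ∧ τ i.succ ≤ σ i.succ := by
  by_contra! hcon
  -- Without such a regime, `σ i ≤ τ i` always passes on to a strict inequality at the next index,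
  -- which is absurd at the common end point.
  have h : ∀ i : Fin (n + 2), σ i ≤ τ i := by
    intro i
    induction i using Fin.induction with
    | zero => exact h0
    | succ i ih => exact (hcon i ih).le
  have := hcon (Fin.last n) (h _)
  rw [Fin.succ_last] at this
  exact absurd hlast (not_le.2 this)

/-- Two different strictly increasing partitions: some point of the first lies strictly between
two consecutive points of the second. -/
lemma exists_strictly_between {n : ℕ} {f g : Fin (n + 2) → ℝ} (hf : StrictMono f)
    (hg : StrictMono g) (h0 : g 0 ≤ f 0) (hlast : f (Fin.last (n + 1)) ≤ g (Fin.last (n + 1)))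
    (hne : f ≠ g) : ∃ i : Fin (n + 2), ∃ j : Fin (n + 1), g j.castSucc < f i ∧ f i < g j.succ := by
  by_contra! hcon
  -- A value of `f` missed by `g` and by all gaps of `g` would exceed every `g j`, by induction. The
  -- ranges then agree by cardinality, and a strictly increasing function is determined by its
  -- range.
  have hsub : Set.range f ⊆ Set.range g := by
    rintro _ ⟨i, rfl⟩
    by_contra hi
    have hi' : ∀ j, g j ≠ f i := fun j hj => hi ⟨j, hj⟩
    have hlt : ∀ j : Fin (n + 2), g j < f i := by
      intro j
      induction j using Fin.induction with
      | zero => exact lt_of_le_of_ne (h0.trans (hf.monotone (Fin.zero_le i))) (hi' 0)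
      | succ j ih => exact lt_of_le_of_ne (hcon i j ih) (hi' _)
    exact absurd (hlt (Fin.last _)) (not_lt.2 ((hf.monotone (Fin.le_last i)).trans hlast))
  have heq : Set.range f = Set.range g := by
    refine Set.eq_of_subset_of_ncard_le hsub ?_ (Set.finite_range g)
    rw [← Set.image_univ, ← Set.image_univ, Set.ncard_image_of_injective _ hf.injective,
      Set.ncard_image_of_injective _ hg.injective]
  exact hne ((StrictMono.range_inj hf hg).1 heq)

end Combinatorics

/-! ### Identification of the limiting fractions. -/

section Identification

variable {k p q : ℕ} {H : Type*} [NormedAddCommGroup H] [InnerProductSpace ℝ H]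
  {α : ℝ} {Φ : Vec q → H}

/-- The mean embedding of the mixture over the true regimes that makes up the `i`-th regime of the
partition with limiting fractions `lam`, with `M l` the embedding of the `l`-th component. -/
def mixMean (lam lam0 : Fin (k + 2) → ℝ) (i : Fin (k + 1)) (M : Fin (k + 1) → H) : H :=
  (lam i.succ - lam i.castSucc)⁻¹ • ∑ l,
    overlap (lam i.castSucc) (lam i.succ) (lam0 l.castSucc) (lam0 l.succ) • M l

lemma IsPowerEmbedding.tendsto_multiEnergy_of_fractions (hΦ : IsPowerEmbedding α Φ)
    (hα : α ∈ Set.Ioo (0 : ℝ) 2) {lam0 : Fin (k + 2) → ℝ} (h1 : A1 lam0)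
    {x : ℕ → ℕ → Vec p} {u y : ℕ → ℕ → Vec q} {β0 : Fin (k + 1) → Coef p q}
    (hmodel : ∀ T, ∀ l, ∀ t ∈ block (trueCP lam0 T) l, y T t = β0 l (x T t) + u T t) {C : ℝ}
    (hC : ∀ᶠ T in atTop, momentAvg α T (x T) (u T) ≤ C) {bc : Fin (k + 1) → Coef p q}
    {b : ℕ → Fin (k + 1) → Coef p q} (hb : ∀ i, Tendsto (fun T => b T i) atTop (𝓝 (bc i)))
    {τ : ℕ → Fin (k + 2) → ℕ}
    (hτ : ∀ᶠ T in atTop, Monotone (τ T) ∧ τ T (Fin.last (k + 1)) = T) {lam : Fin (k + 2) → ℝ}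
    (hlam : StrictMono lam) (hlam0 : 0 ≤ lam 0)
    (hfrac : ∀ j, Tendsto (fun T => (τ T j : ℝ) / T) atTop (𝓝 (lam j)))
    {M : Fin (k + 1) → Fin (k + 1) → H}
    (hM : ∀ i l, Tendsto (fun T : ℕ => (T : ℝ)⁻¹ *
      ‖∑ t ∈ Finset.Ioc ⌊(T : ℝ) * lam i.castSucc⌋₊ ⌊(T : ℝ) * lam i.succ⌋₊ ∩
        block (trueCP lam0 T) l, (Φ (u T t + (β0 l - bc i) (x T t)) - M i l)‖) atTop (𝓝 0)) :
    Tendsto (fun T => multiEnergy α T (x T) (y T) (τ T) (b T) / T) atTop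
      (𝓝 (∑ i, ∑ j ∈ Finset.Ioi i, (lam i.succ - lam i.castSucc) * (lam j.succ - lam j.castSucc) *
        ‖mixMean lam lam0 i (M i) - mixMean lam lam0 j (M j)‖ ^ 2)) := by
  have hlt : ∀ i : Fin (k + 1), lam i.castSucc < lam i.succ := fun i => hlam Fin.castSucc_lt_succ
  have hlimC : ∀ i, Tendsto (fun T => ∑ l, 4 * (1 + ‖β0 l - b T i‖ ^ α) * C) atTop
      (𝓝 (∑ l, 4 * (1 + ‖β0 l - bc i‖ ^ α) * C)) := fun i =>
    tendsto_finsetSum _ fun l _ => (((((tendsto_const_nhds.sub (hb i)).norm).rpow_const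
      (Or.inr hα.1.le)).const_add 1).const_mul 4).mul_const C
  -- The `+ 1` in the moment bound leaves room for `b T i` in place of its limit `bc i`.
  refine hΦ.tendsto_multiEnergy_div hα.1 (fun i => sub_pos.2 (hlt i))
    (fun i => tendsto_card_Ioc (hlt i).le (hfrac _) (hfrac _))
    (fun i => hΦ.tendsto_avg_block hα h1 hmodel hC (hb i) hτ hlam hlam0 hfrac (hM i))
    (C := fun i => (∑ l, 4 * (1 + ‖β0 l - bc i‖ ^ α) * C) + 1) fun i => ?_
  filter_upwards [hτ, hC, eventually_gt_atTop 0,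
    (hlimC i).eventually_lt_const (lt_add_one _)] with T hT hCT hT0 hlimT
  have hs := sum_sum_Ioc_eq
    (fun t => if t ∈ block (τ T) i then ‖y T t - b T i (x T t)‖ ^ α else 0) (trueCP_mono h1 T)
  rw [trueCP_zero h1, trueCP_last h1] at hs
  simp only [Finset.sum_ite_mem] at hs
  have hsubset : Finset.Ioc 0 T ∩ block (τ T) i = block (τ T) i :=
    Finset.inter_eq_right.2 (block_subset_Icc hT.1 hT.2 i)
  rw [hsubset] at hs
  rw [← hs]
  calc _ ≤ ∑ l, 4 * (1 + ‖β0 l - b T i‖ ^ α) * C * T := by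
        refine Finset.sum_le_sum fun l _ => ?_
        have hsub : block (trueCP lam0 T) l ∩ block (τ T) i ⊆ Finset.Icc 1 T :=
          Finset.inter_subset_right.trans (block_subset_Icc hT.1 hT.2 i)
        have hle := sum_norm_add_apply_rpow_le hα hT0 hsub (x T) (u T) (β0 l - b T i)
        refine (le_of_eq ?_).trans (hle.trans (by gcongr))
        refine Finset.sum_congr rfl fun t ht => ?_
        rw [hmodel T l t (Finset.mem_inter.1 ht).1]
        congr 2
        simp only [sub_apply]
        abel
    _ = (∑ l, 4 * (1 + ‖β0 l - b T i‖ ^ α) * C) * T := by rw [Finset.sum_mul]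
    _ ≤ _ := by gcongr

lemma mixMean_of_regime_le {lam lam0 : Fin (k + 2) → ℝ} (h1 : A1 lam0) (hlam : StrictMono lam)
    {i : Fin (k + 1)} (ha : lam0 i.castSucc ≤ lam i.castSucc) (hb : lam i.succ ≤ lam0 i.succ)
    (M : Fin (k + 1) → H) : mixMean lam lam0 i M = M i := by
  have hlt : lam i.castSucc < lam i.succ := hlam Fin.castSucc_lt_succ
  rw [mixMean]
  simp_rw [overlap_regime h1 hlt.le ha hb, ite_smul, zero_smul]
  rw [Finset.sum_ite_eq' Finset.univ i, if_pos (Finset.mem_univ i),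
    inv_smul_smul₀ (sub_pos.2 hlt).ne']

variable [CompleteSpace H]

/-- The limiting fractions of partitions along which the data obey the law of large numbers and the
goodness-of-fit statistic does not exceed its value at the true partition are the true ones. -/
lemma IsPowerEmbedding.fractions_eq (hΦ : IsPowerEmbedding α Φ)
    (hinj : ∀ F G : Measure (Vec q), IsProbabilityMeasure F → IsProbabilityMeasure G →
        Integrable Φ F → Integrable Φ G → ∫ v, Φ v ∂F = ∫ v, Φ v ∂G → F = G)
    (hα : α ∈ Set.Ioo (0 : ℝ) 2) {lam0 : Fin (k + 2) → ℝ} (h1 : A1 lam0)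
    {μ : Measure (Vec q)} {ν : Fin (k + 1) → Measure (Vec p)} [IsProbabilityMeasure μ]
    [∀ l, IsProbabilityMeasure (ν l)] (hμ : Integrable (fun z => ‖z‖ ^ (2 * α)) μ)
    (hν : ∀ l, Integrable (fun z => ‖z‖ ^ (2 * α)) (ν l))
    {x : ℕ → ℕ → Vec p} {u y : ℕ → ℕ → Vec q} {β0 : Fin (k + 1) → Coef p q}
    (hchange : GenuineChanges β0 ν)
    (hmodel : ∀ T, ∀ l, ∀ t ∈ block (trueCP lam0 T) l, y T t = β0 l (x T t) + u T t) {C : ℝ}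
    (hC : ∀ᶠ T in atTop, momentAvg α T (x T) (u T) ≤ C) {bc : Fin (k + 1) → Coef p q}
    {b b0 : ℕ → Fin (k + 1) → Coef p q} (hb : ∀ i, Tendsto (fun T => b T i) atTop (𝓝 (bc i)))
    (hb0 : ∀ i, Tendsto (fun T => b0 T i) atTop (𝓝 (β0 i)))
    {τ : ℕ → Fin (k + 2) → ℕ}
    (hτ : ∀ᶠ T in atTop, Monotone (τ T) ∧ τ T (Fin.last (k + 1)) = T) {lam : Fin (k + 2) → ℝ}
    (hlam : StrictMono lam) (hlam0 : lam 0 = 0) (hlam1 : lam (Fin.last (k + 1)) = 1)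
    (hfrac : ∀ j, Tendsto (fun T => (τ T j : ℝ) / T) atTop (𝓝 (lam j)))
    (hcons : ∀ i, ∀ η : ℝ, 0 < η → ∀ᶠ T in atTop, trueCP lam0 T i.castSucc ≤ τ T i.castSucc →
      τ T i.succ ≤ trueCP lam0 T i.succ → ‖b T i - β0 i‖ < η)
    (hle : ∀ᶠ T in atTop, multiEnergy α T (x T) (y T) (τ T) (b T) ≤
      multiEnergy α T (x T) (y T) (trueCP lam0 T) (b0 T))
    (hM : ∀ i l, Tendsto (fun T : ℕ => (T : ℝ)⁻¹ *
      ‖∑ t ∈ Finset.Ioc ⌊(T : ℝ) * lam i.castSucc⌋₊ ⌊(T : ℝ) * lam i.succ⌋₊ ∩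
        block (trueCP lam0 T) l, (Φ (u T t + (β0 l - bc i) (x T t)) -
          popMean Φ μ (ν l) (β0 l - bc i))‖) atTop (𝓝 0))
    (hM0 : ∀ i l, Tendsto (fun T : ℕ => (T : ℝ)⁻¹ *
      ‖∑ t ∈ Finset.Ioc ⌊(T : ℝ) * lam0 i.castSucc⌋₊ ⌊(T : ℝ) * lam0 i.succ⌋₊ ∩
        block (trueCP lam0 T) l, (Φ (u T t + (β0 l - β0 i) (x T t)) -
          popMean Φ μ (ν l) (β0 l - β0 i))‖) atTop (𝓝 0)) :
    lam0 = lam := by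
  by_contra hne
  have hlt : ∀ i : Fin (k + 1), lam i.castSucc < lam i.succ := fun i => hlam Fin.castSucc_lt_succ
  set m : Fin (k + 1) → H := fun i =>
    mixMean lam lam0 i fun l => popMean Φ μ (ν l) (β0 l - bc i) with hm
  have hlim := hΦ.tendsto_multiEnergy_of_fractions hα h1 hmodel hC hb hτ hlam hlam0.ge hfrac hM
  have hlim0 := hΦ.tendsto_multiEnergy_of_fractions hα h1 hmodel hC hb0
    (Eventually.of_forall fun T => ⟨trueCP_mono h1 T, trueCP_last h1 T⟩) h1.1 h1.2.1.ge
    (tendsto_trueCP_div h1) hM0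
  -- A true regime is unmixed and has the right coefficient, so its residuals behave like the
  -- disturbances and the limiting statistic is `0`.
  have hm0 : ∀ i, mixMean lam0 lam0 i (fun l => popMean Φ μ (ν l) (β0 l - β0 i)) =
      ∫ v, Φ v ∂μ := fun i => by
    rw [mixMean_of_regime_le h1 h1.1 le_rfl le_rfl, sub_self, popMean_zero]
  simp_rw [hm0, sub_self, norm_zero] at hlim0
  have hle0 := le_of_tendsto_of_tendsto hlim hlim0 (hle.mono fun T hT =>
    div_le_div_of_nonneg_right hT (Nat.cast_nonneg T))
  simp only [ne_eq, OfNat.ofNat_ne_zero, not_false_eq_true, zero_pow, mul_zero,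
    Finset.sum_const_zero] at hle0
  have hterm : ∀ i j, 0 ≤ (lam i.succ - lam i.castSucc) * (lam j.succ - lam j.castSucc) *
      ‖m i - m j‖ ^ 2 := fun i j => mul_nonneg (mul_nonneg (sub_nonneg.2 (hlt i).le)
        (sub_nonneg.2 (hlt j).le)) (sq_nonneg _)
  have hmlt : ∀ i j, i < j → m i = m j := by
    intro i j hij
    have h2 := (Finset.sum_eq_zero_iff_of_nonneg fun i _ =>
      Finset.sum_nonneg fun j _ => hterm i j).1 (le_antisymm hle0 (Finset.sum_nonneg fun i _ =>
        Finset.sum_nonneg fun j _ => hterm i j)) i (Finset.mem_univ i)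
    have h3 := (Finset.sum_eq_zero_iff_of_nonneg fun j _ => hterm i j).1 h2 j
      (Finset.mem_Ioi.2 hij)
    have h4 : ‖m i - m j‖ ^ 2 = 0 := (mul_eq_zero.1 h3).resolve_left
      (mul_pos (sub_pos.2 (hlt i)) (sub_pos.2 (hlt j))).ne'
    exact sub_eq_zero.1 (norm_eq_zero.1 (pow_eq_zero_iff two_ne_zero |>.1 h4))
  have hmeq : ∀ i j, m i = m j := by
    intro i j
    rcases lt_trichotomy i j with h | h | h
    · exact hmlt i j h
    · rw [h]
    · exact (hmlt j i h).symm
  -- For each large `T` some index works; there are finitely many, so one recurs.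
  obtain ⟨i, hi⟩ : ∃ i : Fin (k + 1), ∃ᶠ T in atTop, trueCP lam0 T i.castSucc ≤ τ T i.castSucc ∧
      τ T i.succ ≤ trueCP lam0 T i.succ := by
    by_contra! hcon
    have h2 := eventually_all.2 hcon
    obtain ⟨T, hT, hT'⟩ := (h2.and hτ).exists
    obtain ⟨i, hi⟩ := exists_regime_le (τ := τ T) (σ := trueCP lam0 T)
      (by rw [trueCP_zero h1]; exact Nat.zero_le _) (by rw [hT'.2, trueCP_last h1])
    exact absurd hi.2 (not_le.2 (hT i hi.1))
  -- `b T i` converges along all `T`, so consistency along the recurring `T` identifies its limit.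
  have hbi : bc i = β0 i := by
    by_contra hbne
    have hpos : 0 < ‖bc i - β0 i‖ := norm_pos_iff.2 (sub_ne_zero.2 hbne)
    have hnear := (((hb i).sub_const (β0 i)).norm).eventually_const_lt (half_lt_self hpos)
    obtain ⟨T, hT, hT1, hT2⟩ :=
      (hi.and_eventually (hnear.and (hcons i _ (half_pos hpos)))).exists
    exact absurd (hT2 hT.1 hT.2) (not_lt.2 hT1.le)
  have hfreq : ∀ (f g : ℕ → ℕ) (a c : ℝ), Tendsto (fun T => (f T : ℝ) / T) atTop (𝓝 a) →
      Tendsto (fun T => (g T : ℝ) / T) atTop (𝓝 c) → (∃ᶠ T in atTop, f T ≤ g T) → a ≤ c := by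
    intro f g a c hf hg hfg
    by_contra! hac
    obtain ⟨T, hT, hT'⟩ := (hfg.and_eventually (hg.eventually_lt hf hac)).exists
    refine absurd hT' (not_lt.2 ?_)
    exact div_le_div_of_nonneg_right (Nat.cast_le.2 hT) (Nat.cast_nonneg T)
  have hmi : m i = ∫ v, Φ v ∂μ := by
    simp only [hm]
    rw [mixMean_of_regime_le h1 hlam
      (hfreq _ _ _ _ (tendsto_trueCP_div h1 _) (hfrac _) (hi.mono fun T h => h.1))
      (hfreq _ _ _ _ (hfrac _) (tendsto_trueCP_div h1 _) (hi.mono fun T h => h.2)), hbi, sub_self,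
      popMean_zero]
  -- The limiting regime `j` contains a true change point in its interior, so it mixes two
  -- neighbouring true regimes.
  obtain ⟨r, j, hr1, hr2⟩ := exists_strictly_between h1.1 hlam (by rw [hlam0, h1.2.1])
    (by rw [hlam1, h1.2.2]) hne
  have hj0 : 0 ≤ lam j.castSucc := by rw [← hlam0]; exact hlam.monotone (Fin.zero_le _)
  have hj1 : lam j.succ ≤ 1 := by rw [← hlam1]; exact hlam.monotone (Fin.le_last _)
  obtain ⟨l, rfl⟩ : ∃ l : Fin k, l.succ.castSucc = r := by
    have hr0 : r ≠ 0 := by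
      rintro rfl; rw [h1.2.1] at hr1; linarith
    have hrl : r ≠ Fin.last (k + 1) := by
      rintro rfl; rw [h1.2.2] at hr2; linarith
    obtain ⟨s, rfl⟩ := Fin.exists_succ_eq.2 hr0
    have hs : s ≠ Fin.last k := by
      rintro rfl; exact hrl (Fin.succ_last _)
    obtain ⟨l, rfl⟩ := Fin.exists_castSucc_eq.2 hs
    exact ⟨l, rfl⟩
  have hπ : 0 < lam j.succ - lam j.castSucc := sub_pos.2 (hlt j)
  set w : Fin (k + 1) → ℝ := fun l => (lam j.succ - lam j.castSucc)⁻¹ *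
    overlap (lam j.castSucc) (lam j.succ) (lam0 l.castSucc) (lam0 l.succ) with hw
  have hw0 : ∀ l, 0 ≤ w l := fun l => mul_nonneg (inv_nonneg.2 hπ.le) (overlap_nonneg _ _ _ _)
  have hw1 : ∑ l, w l = 1 := by
    simp only [hw]
    rw [← Finset.mul_sum, sum_overlap h1 hj0 (hlt j).le hj1, inv_mul_cancel₀ hπ.ne']
  have hmix : ∑ l, w l • popMean Φ μ (ν l) (β0 l - bc j) = ∫ v, Φ v ∂μ := by
    rw [← hmi, hmeq i j]
    simp only [hm, mixMean, hw]
    rw [Finset.smul_sum]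
    simp_rw [smul_smul]
  have hzero : ∀ l, 0 < w l → ∀ᵐ z ∂(ν l), bc j z = β0 l z := by
    intro l hl
    filter_upwards [ae_apply_eq_zero_of_sum_popMean_eq hΦ hα hinj hμ hν hw0 hw1 hmix hl] with z hz
    rw [sub_apply, sub_eq_zero] at hz
    exact hz.symm
  refine hchange l ⟨bc j, hzero _ ?_, hzero _ ?_⟩
  · exact mul_pos (inv_pos.2 hπ) (overlap_pos (y := lam0 l.succ.castSucc) ⟨⟨hr1, hr2⟩, Or.inl
      ⟨h1.1 (by rw [Fin.castSucc_lt_castSucc_iff]; exact Fin.castSucc_lt_succ), by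
        rw [Fin.succ_castSucc]⟩⟩)
  · exact mul_pos (inv_pos.2 hπ) (overlap_pos (y := lam0 l.succ.castSucc) ⟨⟨hr1, hr2⟩, Or.inr
      ⟨rfl, h1.1 Fin.castSucc_lt_succ⟩⟩)

end Identification

/-! ### Passage from chosen outcomes to limiting fractions. -/

section Main

variable {Ω : Type*} [MeasurableSpace Ω] {P : Measure Ω}

lemma NegligibleInProb.of_tendstoInMeasure {E : Type*} [NormedAddCommGroup E] {f : ℕ → Ω → E}
    {c : E} (h : TendstoInMeasure P f atTop fun _ => c) :
    NegligibleInProb P fun T ω => ‖f T ω - c‖ :=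
  tendstoInMeasure_iff_norm.1 h

lemma tendsto_of_forall_eventually_norm_sub_lt {E : Type*} [NormedAddCommGroup E] {f : ℕ → E}
    {c : E} (h : ∀ η : ℝ, 0 < η → ∀ᶠ T in atTop, ‖f T - c‖ < η) : Tendsto f atTop (𝓝 c) :=
  Metric.tendsto_nhds.2 fun η hη => (h η hη).mono fun T hT => by rwa [dist_eq_norm]

lemma tendsto_zero_of_forall_eventually_lt {f : ℕ → ℝ} (h0 : ∀ T, 0 ≤ f T)
    (h : ∀ η : ℝ, 0 < η → ∀ᶠ T in atTop, f T < η) : Tendsto f atTop (𝓝 0) :=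
  tendsto_of_forall_eventually_norm_sub_lt fun η hη => (h η hη).mono fun T hT => by
    rwa [sub_zero, Real.norm_of_nonneg (h0 T)]

/-- Limiting fractions completed by the end points `0` and `1`. -/
def extendFractions {k : ℕ} (lam : Fin k → ℝ) : Fin (k + 2) → ℝ :=
  Fin.cons (0 : ℝ) (Fin.snoc (α := fun _ => ℝ) lam 1)

lemma extendFractions_zero {k : ℕ} (lam : Fin k → ℝ) : extendFractions lam 0 = 0 := rfl

lemma extendFractions_last {k : ℕ} (lam : Fin k → ℝ) :
    extendFractions lam (Fin.last (k + 1)) = 1 := by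
  rw [extendFractions, ← Fin.succ_last, Fin.cons_succ, Fin.snoc_last]

lemma extendFractions_inner {k : ℕ} (lam : Fin k → ℝ) (j : Fin k) :
    extendFractions lam j.succ.castSucc = lam j := by
  rw [extendFractions, ← Fin.succ_castSucc, Fin.cons_succ, Fin.snoc_castSucc]

lemma forall_fin_add_two {k : ℕ} {Q : Fin (k + 2) → Prop} (h0 : Q 0)
    (h1 : Q (Fin.last (k + 1))) (h : ∀ j : Fin k, Q j.succ.castSucc) : ∀ j, Q j := by
  intro j
  induction j using Fin.cases with
  | zero => exact h0
  | succ j =>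
    induction j using Fin.lastCases with
    | last => rwa [Fin.succ_last]
    | cast j => exact h j

lemma tendsto_div_extendFractions {k : ℕ} {ε : ℝ} {τ : ℕ → Fin (k + 2) → ℕ}
    (hτ : ∀ᶠ T in atTop, IsAdmissible ε T (τ T)) {lam : Fin k → ℝ}
    (h : ∀ j : Fin k, Tendsto (fun T => (τ T j.succ.castSucc : ℝ) / T) atTop (𝓝 (lam j)))
    (j : Fin (k + 2)) :
    Tendsto (fun T => (τ T j : ℝ) / T) atTop (𝓝 (extendFractions lam j)) := by
  revert j
  refine forall_fin_add_two ?_ ?_ fun j => ?_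
  · rw [extendFractions_zero]
    refine tendsto_const_nhds.congr' ?_
    filter_upwards [hτ] with T hT
    simp [hT.1]
  · rw [extendFractions_last]
    refine tendsto_const_nhds.congr' ?_
    filter_upwards [hτ, eventually_gt_atTop 0] with T hT hT0
    rw [hT.2.1, div_self (by exact_mod_cast hT0.ne')]
  · rw [extendFractions_inner]
    exact h j

/-- The gap `ε` between consecutive fractions survives in the limit. -/
lemma strictMono_of_isAdmissible {k : ℕ} {ε : ℝ} (hε : 0 < ε) {τ : ℕ → Fin (k + 2) → ℕ}
    (hτ : ∀ᶠ T in atTop, IsAdmissible ε T (τ T)) {lam : Fin (k + 2) → ℝ}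
    (h : ∀ j, Tendsto (fun T => (τ T j : ℝ) / T) atTop (𝓝 (lam j))) : StrictMono lam := by
  refine Fin.strictMono_iff_lt_succ.2 fun i => ?_
  have h1 : ε ≤ lam i.succ - lam i.castSucc := by
    refine ge_of_tendsto ((h i.succ).sub (h i.castSucc)) ?_
    filter_upwards [hτ, eventually_gt_atTop 0] with T hT hT0
    have hT0' : (0 : ℝ) < T := by exact_mod_cast hT0
    rw [← sub_div, le_div_iff₀ hT0']
    exact hT.2.2 i
  linarith

/-- Excludes `q = 0`, where any matrix fits both regimes; the embedding needs a nontrivial space. -/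
lemma GenuineChanges.nontrivial {k p q : ℕ} {β0 : Fin (k + 1) → Coef p q}
    {ν : Fin (k + 1) → Measure (Vec p)} (h : GenuineChanges β0 ν) (j : Fin k) :
    Nontrivial (Vec q) := by
  by_contra hn
  rw [not_nontrivial_iff_subsingleton] at hn
  exact h j ⟨0, Eventually.of_forall fun z => Subsingleton.elim _ _,
    Eventually.of_forall fun z => Subsingleton.elim _ _⟩

end Main

end EnergyCP

end

theorem proposition2 {Ω : Type*} [MeasurableSpace Ω] (P : Measure Ω) [IsProbabilityMeasure P]
    {k p q : ℕ} (α ε : ℝ) (hα : α ∈ Set.Ioo (0 : ℝ) 2) (hε : 0 < ε)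
    -- the model; data for sample size `T` are indexed as `x T t`, `y T t`, `u T t`
    (lam0 : Fin (k + 2) → ℝ) (β0 : Fin (k + 1) → EnergyCP.Coef p q)
    (x : ℕ → ℕ → Ω → EnergyCP.Vec p) (y u : ℕ → ℕ → Ω → EnergyCP.Vec q)
    (ν : Fin (k + 1) → Measure (EnergyCP.Vec p)) (μ : Measure (EnergyCP.Vec q))
    (hmodel : EnergyCP.Model lam0 β0 x y u)
    (hchange : EnergyCP.GenuineChanges β0 ν)
    -- the regularized estimators of the coefficients for a given partition
    (ψ : EnergyCP.Vec q → ℝ) (φ : (Fin (k + 1) → EnergyCP.Coef p q) → ℝ) (γ : ℕ → ℝ)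
    (hψ : StrictConvexOn ℝ Set.univ ψ) (hψ0 : IsMinOn ψ Set.univ 0)
    (hφ : ConvexOn ℝ Set.univ φ) (hφ0 : IsMinOn φ Set.univ 0) (hγ : ∀ T, 0 ≤ γ T)
    (βhat : ℕ → (Fin (k + 2) → ℕ) → Ω → Fin (k + 1) → EnergyCP.Coef p q)
    (hβhat : ∀ T τ, EnergyCP.IsAdmissible ε T τ → ∀ ω,
      IsMinOn (EnergyCP.risk ψ φ (γ T) (fun t => x T t ω) (fun t => y T t ω) τ) Set.univ
        (βhat T τ ω))
    -- the true partition is among the partitions over which one minimizes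
    (hεlam : ∀ i : Fin (k + 1), ε < lam0 i.succ - lam0 i.castSucc)
    (h1 : EnergyCP.A1 lam0)
    (h2 : EnergyCP.A2 P α lam0 x ν)
    (h3 : EnergyCP.A3 P α x u μ)
    (h4 : EnergyCP.A4 P ε lam0 β0 βhat)
    (h5 : EnergyCP.A5 P α lam0 x u ν μ)
    -- the energy-distance minimizing change points
    (That : ℕ → Ω → Fin (k + 2) → ℕ) (hThat_meas : ∀ T, Measurable (That T))
    (hThat : ∀ᶠ T in atTop, ∀ ω, EnergyCP.IsAdmissible ε T (That T ω) ∧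
      IsMinOn (fun τ => EnergyCP.multiEnergy α T (fun t => x T t ω) (fun t => y T t ω) τ
        (βhat T τ ω)) {τ | EnergyCP.IsAdmissible ε T τ} (That T ω))
    (lamhat : Fin k → ℝ) (hlamhat : ∀ j, lamhat j ∈ Set.Ioo (0 : ℝ) 1)
    (hconv : EnergyCP.FractionsTendsto P That lamhat) :
    ∀ j : Fin k, lamhat j = lam0 j.succ.castSucc := by
  classical
  intro j
  have hq := hchange.nontrivial j
  have hμP := h3.isProbabilityMeasure
  have hνP := EnergyCP.A2.isProbabilityMeasure h1 h2
  obtain ⟨Φ, hΦ0, hΦsq, hinj⟩ := EnergyCP.exists_hilbert_embedding (E := EnergyCP.Vec q) hα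
  have hΦ : EnergyCP.IsPowerEmbedding α Φ := ⟨hΦ0, hΦsq⟩
  set lam := EnergyCP.extendFractions lamhat with hlam
  obtain ⟨⟨bc, hbc⟩, hcons⟩ := h4 That hThat_meas (hThat.mono fun T h ω => (h ω).1) lamhat hconv
  have hadm0 := EnergyCP.eventually_isAdmissible_trueCP h1 hεlam
  -- (A4) also applies to the nonrandom true partition, whose regimes trivially lie in the true
  -- ones; its estimators are thus consistent.
  have hcons0 := (h4 (fun T _ => EnergyCP.trueCP lam0 T) (fun T => measurable_const)
    (hadm0.mono fun T h _ => h) (fun j => lam0 j.succ.castSucc) (fun j => by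
      refine tendstoInMeasure_of_tendsto_ae (fun T => aestronglyMeasurable_const)
        (Eventually.of_forall fun _ => EnergyCP.tendsto_trueCP_div h1 _))).2
  simp only [le_refl, true_and] at hcons0
  obtain ⟨C, hC⟩ := EnergyCP.exists_measure_momentAvg_gt_le h1 h2 h3
  have hfrac := fun j => EnergyCP.NegligibleInProb.of_tendstoInMeasure (hconv j)
  have hbc' := fun i => EnergyCP.NegligibleInProb.of_tendstoInMeasure (hbc i)
  -- The conditional consistency in (A4), recast as a negligible sequence by setting the error to
  -- `0` when the regime is not contained in the true one.
  have hin : ∀ i : Fin (k + 1), EnergyCP.NegligibleInProb P fun T ω =>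
      if EnergyCP.trueCP lam0 T i.castSucc ≤ That T ω i.castSucc ∧
        That T ω i.succ ≤ EnergyCP.trueCP lam0 T i.succ
      then ‖βhat T (That T ω) ω i - β0 i‖ else 0 := by
    intro i η hη
    refine (hcons i η hη).congr fun T => ?_
    congr 1
    ext ω
    simp only [Set.mem_ofPred_eq]
    split_ifs with h
    · simp [h]
    · simp only [not_le.2 hη, iff_false]
      exact fun h' => h ⟨h'.1, h'.2.1⟩
  have hb0 : ∀ i : Fin (k + 1), EnergyCP.NegligibleInProb P fun T ω =>
      ‖βhat T (EnergyCP.trueCP lam0 T) ω i - β0 i‖ := fun i η hη => hcons0 i η hη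
  -- Used twice: with the limits `lam`, `bc` of the estimated quantities and with the true `lam0`,
  -- `β0`.
  have hlln := fun (lam : Fin (k + 2) → ℝ) (b : Fin (k + 1) → EnergyCP.Coef p q)
      (a : Fin (k + 1) × Fin (k + 1)) =>
    EnergyCP.negligibleInProb_norm_sum_sub hΦ hα h1 h2 h3 h5 (β0 a.2 - b a.1) a.2
      (A := fun T => Finset.Ioc ⌊(T : ℝ) * lam a.1.castSucc⌋₊ ⌊(T : ℝ) * lam a.1.succ⌋₊ ∩
        EnergyCP.block (EnergyCP.trueCP lam0 T) a.2) (fun T => Finset.inter_subset_right)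
  obtain ⟨ω, hωC, hω⟩ := EnergyCP.exists_selection
    (f := Sum.elim _ (Sum.elim _ (Sum.elim _ (Sum.elim _ (Sum.elim _ _)))))
    (Sum.rec hfrac (Sum.rec hbc' (Sum.rec hin (Sum.rec hb0
      (Sum.rec (hlln lam bc) (hlln lam0 β0)))))) hC
  simp only [Sum.forall, Sum.elim_inl, Sum.elim_inr] at hω
  obtain ⟨hω1, hω2, hω3, hω4, hω5, hω6⟩ := hω
  have hadm : ∀ᶠ T in atTop, EnergyCP.IsAdmissible ε T (That T (ω T)) :=
    hThat.mono fun T h => (h (ω T)).1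
  have hfrac' := EnergyCP.tendsto_div_extendFractions hadm fun j =>
    EnergyCP.tendsto_of_forall_eventually_norm_sub_lt (hω1 j)
  have heq := hΦ.fractions_eq hinj hα h1 h3.2.2.2 h2.2 (x := fun T t => x T t (ω T))
    (u := fun T t => u T t (ω T)) (y := fun T t => y T t (ω T)) hchange
    (fun T l t ht => hmodel T l t ht (ω T)) hωC
    (b := fun T => βhat T (That T (ω T)) (ω T))
    (b0 := fun T => βhat T (EnergyCP.trueCP lam0 T) (ω T))
    (fun i => EnergyCP.tendsto_of_forall_eventually_norm_sub_lt (hω2 i))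
    (fun i => EnergyCP.tendsto_of_forall_eventually_norm_sub_lt (hω4 i))
    (τ := fun T => That T (ω T)) (hadm.mono fun T h => ⟨h.monotone hε, h.2.1⟩)
    (EnergyCP.strictMono_of_isAdmissible hε hadm hfrac') (EnergyCP.extendFractions_zero _)
    (EnergyCP.extendFractions_last _) hfrac'
    (fun i η hη => (hω3 i η hη).mono fun T hT ha hb =>
      lt_of_eq_of_lt (if_pos ⟨ha, hb⟩).symm hT)
    -- Minimality is used only against the true partition, which is eventually admissible.
    ((hThat.and hadm0).mono fun T h => (h.1 (ω T)).2 h.2)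
    (fun i l => EnergyCP.tendsto_zero_of_forall_eventually_lt (fun T => by positivity)
      (hω5 (i, l)))
    (fun i l => EnergyCP.tendsto_zero_of_forall_eventually_lt (fun T => by positivity)
      (hω6 (i, l)))
  rw [heq, EnergyCP.extendFractions_inner]
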